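/- **Setting.** Let $d,q\in\mathbb N$, let $F:\mathbb R^d\times\mathbb R^q\to\mathbb R$ be measurable, and for each $\theta\in\mathbb R^d$ let $X_\theta=\mu_\theta^{-1}(U)$ with $U$ uniform on $(0,1]^q$, where $(\theta,u)\mapsto\mu_\theta^{-1}(u)\in\mathbb R^q$ is measurable. Put $f(\theta)=\mathbb E[F(\theta,X_\theta)]$. Assume that $f$ is differentiable and bounded below, that $\nabla f$ is Lipschitz on $\mathbb R^d$, that $F(\theta,X_\theta)$ is square integrable for every $\theta$, and that $\sup_\theta \mathrm{Var}(F(\theta,X_\theta))<\infty$. **Algorithm (no stratification, Chebyshev parameters).** Fix $\delta>0$, $\lambda_k=k^{1+\delta}$, $\gamma=2$, constants $\Delta_0,\Delta_{\max},\tilde\eta,\sigma_{\min}^2,\kappa_{as}>0$, $\eta\in(0,1)$, $0<\underline\gamma<1<\overline\gamma$, an integer $n_0\ge1$, and $\theta_0\in\mathbb R^d$. In iteration $k\ge 0$, with incumbent $\theta_k$ and radius $\Delta_k$: 1. The design points are $\theta_k^{(0)}=\theta_k$ and $\theta_k\pm\Delta_k e_j$, $j=1,\dots,d$, so there are $p+1=2d+1$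 of them. At each evaluated point $\theta$ a fresh i.i.d. stream $u^{[1]},u^{[2]},\dots$ of uniform vectors on $(0,1]^q$ is used, independent over all points and iterations. With $\tilde f(\theta,n)$ the mean and $\hat\sigma^2(\theta,n)$ the sample variance (divisor $n-1$; $0$ for $n=1$) of $F(\theta,\mu_\theta^{-1}(u^{[m]}))$, $m\le n$, the sample size is $$N=\min\Big\{n\in\mathbb N:\ n\ge n_0,\ n\ge\lambda_k,\ \sqrt{\lambda_k}\,\sqrt{\tfrac1n\max(\sigma_{\min}^2,\hat\sigma^2(\theta,n))}\le\kappa_{as}\Delta_k^{\gamma}\Big\}$$ ($N=\infty$ if there is no such $n$), and the estimate is $\tilde f(\theta,N)$. 2. $M_k$ is the quadratic model with diagonal Hessian, a combination of $1$, $\theta_j-\theta_{k,j}$, $\tfrac12(\theta_j-\theta_{k,j})^2$, that interpolates the estimates at the design points. The candidate $\theta_k^s$ minimizes $M_k$ over $\{\theta:\|\theta-\theta_k\|_2\le\Delta_k\}$; ties are broken measurably and without using future samples. It is evaluated by the same rule, giving its sample size $N_k^s$. 3. Let $\rho_k$ be the ratio of $\tilde f(\theta_k,N_k^{(0)})-\tilde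 f(\theta_k^s,N_k^s)$ to $M_k(\theta_k)-M_k(\theta_k^s)$ (and $\rho_k=0$ if the denominator vanishes). If $\rho_k\ge\eta$ and $\Delta_k\le\tilde\eta\|\nabla M_k(\theta_k)\|$, then $\theta_{k+1}=\theta_k^s$ and $\Delta_{k+1}=\min(\overline\gamma\Delta_k,\Delta_{\max})$; otherwise $\theta_{k+1}=\theta_k$ and $\Delta_{k+1}=\underline\gamma\Delta_k$. Let $T_\epsilon=\inf\{k:\|\nabla f(\theta_k)\|_2\le\epsilon\}$ and $W_\epsilon^{NS}=\sum_{k=0}^{T_\epsilon}\big(\sum_{i=0}^{2d}N_k^{(i)}+N_k^s\big)\in[0,\infty]$. **Statement.** Almost surely $W_\epsilon^{NS}=\mathcal O(\epsilon^{-(8+2\delta)})$: for almost every $\omega$ there are $C<\infty$ and $\epsilon_0>0$ (which may depend on $\omega$) with $W_\epsilon^{NS}(\omega)\le C\epsilon^{-(8+2\delta)}$ for all $0<\epsilon\le\epsilon_0$. Moreover, this exponent $8+2\delta$ is strictly larger than the exponents of the corresponding rates $\mathcal O(\epsilon^{-a})$ for the stratified variant, namely - $a=\frac{8q+4+2q\delta}{q+2}$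 (bounded gradient of the inverse map); - $a=\frac{8q+2+(2\delta+\varrho)q}{q+1}$ for every $\varrho>0$ with $\varrho q<6+2\delta$ (sub-exponential margins and polynomial $F$, or sub-Gaussian margins and polynomial or exponential $F$); - $a=\frac{(8q+2\delta q+2)\kappa_{\min}-4b_{\max}}{(q+1)\kappa_{\min}-2b_{\max}}$ for all $\kappa_{\min}>0$ and $b_{\max}<\kappa_{\min}/2$ (sub-exponential margins and exponential $F$). -/

import Mathlib

open MeasureTheory ProbabilityTheory
open scoped ENNReal

noncomputable section

namespace SampledTrustRegion

/-- The uniform distribution on the unit cube `(0,1]^q`. -/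
def uniformCube (q : ℕ) : Measure (Fin q → ℝ) :=
  volume.restrict (Set.univ.pi fun _ => Set.Ioc (0 : ℝ) 1)

/-- The data of an unconstrained stochastic optimization problem. `F θ x` is the oracle and
`invMap θ` is the inverse transform `μ_θ⁻¹` that turns a uniform vector on the cube into a sample
of the random vector `X`, whose law may depend on the decision `θ`. -/
structure Problem (d q : ℕ) where
  F : EuclideanSpace ℝ (Fin d) → (Fin q → ℝ) → ℝ
  invMap : EuclideanSpace ℝ (Fin d) → (Fin q → ℝ) → (Fin q → ℝ)

namespace Problem

variable {d q : ℕ}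

/-- The law of the random vector `X` at the decision `θ`. -/
def law (P : Problem d q) (θ : EuclideanSpace ℝ (Fin d)) : Measure (Fin q → ℝ) :=
  (uniformCube q).map (P.invMap θ)

/-- The objective `f θ = 𝔼[F(θ, X)]`. -/
def objective (P : Problem d q) (θ : EuclideanSpace ℝ (Fin d)) : ℝ :=
  ∫ x, P.F θ x ∂(P.law θ)

/-- One oracle call at `θ`, driven by the uniform vector `u`. -/
def oracle (P : Problem d q) (θ : EuclideanSpace ℝ (Fin d)) (u : Fin q → ℝ) : ℝ :=
  P.F θ (P.invMap θ u)

end Problem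

/-- The inputs of the algorithm: initial and maximal trust-region radius, success threshold `η`,
model-gradient constant `ηTilde`, expansion and shrinkage factors, minimal variance `σ²_min` and
constant `κ_as` of the sampling rule, and the least number `n₀` of samples of an evaluation. -/
structure Params where
  Δ₀ : ℝ
  Δmax : ℝ
  η : ℝ
  ηTilde : ℝ
  γup : ℝ
  γlow : ℝ
  σminSq : ℝ
  κas : ℝ
  n₀ : ℕ
  Δ₀_pos : 0 < Δ₀
  Δmax_pos : 0 < Δmax
  η_pos : 0 < η
  η_lt_one : η < 1
  ηTilde_pos : 0 < ηTilde
  one_lt_γup : 1 < γup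
  γlow_pos : 0 < γlow
  γlow_lt_one : γlow < 1
  σminSq_pos : 0 < σminSq
  κas_pos : 0 < κas
  one_le_n₀ : 1 ≤ n₀

/-! ### Sample statistics and the adaptive sampling rule (a single stratum) -/

/-- The average of the first `n` observations. -/
def sampleMean (y : ℕ → ℝ) (n : ℕ) : ℝ := (∑ m ∈ Finset.range n, y m) / n

/-- The sample variance of the first `n` observations, with divisor `n - 1` (it is `0` for a single
observation). -/
def sampleVar (y : ℕ → ℝ) (n : ℕ) : ℝ :=
  (∑ m ∈ Finset.range n, (y m - sampleMean y n) ^ 2) / ((n : ℝ) - 1)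

/-- The estimated variance of the sample mean, truncated from below. -/
def truncVar (par : Params) (y : ℕ → ℝ) (n : ℕ) : ℝ :=
  1 / (n : ℝ) * max par.σminSq (sampleVar y n)

/-- The sample sizes that the rule with deflator `lam`, exponent `γ` and radius `Δ` accepts. The
inequality `√Var ≤ κ Δ^γ / √lam` is multiplied by `√lam`, so that it is void for `lam = 0`. -/
def acceptedSizes (par : Params) (lam γ Δ : ℝ) (y : ℕ → ℝ) : Set ℕ :=
  {n | par.n₀ ≤ n ∧ lam ≤ n ∧ √lam * √(truncVar par y n) ≤ par.κas * Δ ^ γ}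

/-- The adaptive sample size: the least accepted one, and `⊤` if the rule is never satisfied. -/
def sampleSize (par : Params) (lam γ Δ : ℝ) (y : ℕ → ℝ) : ℕ∞ :=
  ⨅ n ∈ acceptedSizes par lam γ Δ y, (n : ℕ∞)

/-! ### The diagonal quadratic interpolation model -/

/-- Indices of the `2d + 1` design points, and of the `2d + 1` basis polynomials. -/
abbrev Node (d : ℕ) := Option (Fin d ⊕ Fin d)

/-- The design points `c`, `c + Δ e_j` and `c - Δ e_j`. -/
def node {d : ℕ} (c : EuclideanSpace ℝ (Fin d)) (Δ : ℝ) : Node d → EuclideanSpace ℝ (Fin d)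
  | none => c
  | some (Sum.inl j) => c + Δ • EuclideanSpace.single j (1 : ℝ)
  | some (Sum.inr j) => c - Δ • EuclideanSpace.single j (1 : ℝ)

/-- The basis polynomials `1`, `x_j - c_j` and `(x_j - c_j)² / 2`. -/
def basisPoly {d : ℕ} (c : EuclideanSpace ℝ (Fin d)) : Node d → EuclideanSpace ℝ (Fin d) → ℝ
  | none, _ => 1
  | some (Sum.inl j), x => x j - c j
  | some (Sum.inr j), x => (x j - c j) ^ 2 / 2

/-- The interpolation matrix: rows are design points, columns are basis polynomials. -/
def interpMatrix {d : ℕ} (c : EuclideanSpace ℝ (Fin d)) (Δ : ℝ) : Matrix (Node d) (Node d) ℝ :=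
  Matrix.of fun i j => basisPoly c j (node c Δ i)

/-- The model with centre `c` and coefficients `β`. -/
def model {d : ℕ} (c : EuclideanSpace ℝ (Fin d)) (β : Node d → ℝ)
    (x : EuclideanSpace ℝ (Fin d)) : ℝ :=
  ∑ j, β j * basisPoly c j x

/-! ### Runs of the algorithm -/

/-- The processes generated by the algorithm: incumbents, radii, model coefficients, candidates. -/
structure Trajectory (Ω : Type*) (d : ℕ) where
  θ : ℕ → Ω → EuclideanSpace ℝ (Fin d)
  Δ : ℕ → Ω → ℝ
  β : ℕ → Ω → Node d → ℝ
  cand : ℕ → Ω → EuclideanSpace ℝ (Fin d)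

section Run

variable {Ω : Type*} {d q : ℕ}

namespace Trajectory

/-- The points evaluated in iteration `k`: `some i` is a design point, `none` the candidate. -/
def point (R : Trajectory Ω d) (k : ℕ) (ω : Ω) : Option (Node d) → EuclideanSpace ℝ (Fin d)
  | some i => node (R.θ k ω) (R.Δ k ω) i
  | none => R.cand k ω

/-- The oracle values at a point of iteration `k`, driven by the stream `U k a`. -/
def obs (R : Trajectory Ω d) (P : Problem d q) (U : ℕ → Option (Node d) → ℕ → Ω → (Fin q → ℝ))
    (k : ℕ) (a : Option (Node d)) (ω : Ω) (m : ℕ) : ℝ :=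
  P.oracle (R.point k ω a) (U k a m ω)

/-- The adaptive sample size at a point of iteration `k`. -/
def size (R : Trajectory Ω d) (P : Problem d q) (par : Params) (lam : ℕ → ℝ) (γ : ℝ)
    (U : ℕ → Option (Node d) → ℕ → Ω → (Fin q → ℝ)) (k : ℕ) (a : Option (Node d)) (ω : Ω) : ℕ∞ :=
  sampleSize par (lam k) γ (R.Δ k ω) (R.obs P U k a ω)

/-- The function estimate at a point of iteration `k`. -/
def estimate (R : Trajectory Ω d) (P : Problem d q) (par : Params) (lam : ℕ → ℝ) (γ : ℝ)
    (U : ℕ → Option (Node d) → ℕ → Ω → (Fin q → ℝ)) (k : ℕ) (a : Option (Node d)) (ω : Ω) : ℝ :=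
  sampleMean (R.obs P U k a ω) (R.size P par lam γ U k a ω).toNat

/-- The trust-region model `M_k`. -/
def surrogate (R : Trajectory Ω d) (k : ℕ) (ω : Ω) : EuclideanSpace ℝ (Fin d) → ℝ :=
  model (R.θ k ω) (R.β k ω)

/-- The acceptance ratio `ρ_k`. -/
def ratio (R : Trajectory Ω d) (P : Problem d q) (par : Params) (lam : ℕ → ℝ) (γ : ℝ)
    (U : ℕ → Option (Node d) → ℕ → Ω → (Fin q → ℝ)) (k : ℕ) (ω : Ω) : ℝ :=
  (R.estimate P par lam γ U k (some none) ω - R.estimate P par lam γ U k none ω) /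
    (R.surrogate k ω (R.θ k ω) - R.surrogate k ω (R.cand k ω))

/-- Iteration `k` is successful. -/
def Success (R : Trajectory Ω d) (P : Problem d q) (par : Params) (lam : ℕ → ℝ) (γ : ℝ)
    (U : ℕ → Option (Node d) → ℕ → Ω → (Fin q → ℝ)) (k : ℕ) (ω : Ω) : Prop :=
  par.η ≤ R.ratio P par lam γ U k ω ∧
    R.Δ k ω ≤ par.ηTilde * ‖gradient (R.surrogate k ω) (R.θ k ω)‖

end Trajectory

/-- The information available when the candidate of iteration `k` is computed: all streams of
earlier iterations and the streams of the design points of iteration `k`. -/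
@[reducible]
def history (U : ℕ → Option (Node d) → ℕ → Ω → (Fin q → ℝ)) (k : ℕ) : MeasurableSpace Ω :=
  ⨆ (j : ℕ) (a : Option (Node d)) (m : ℕ) (_ : j < k ∨ (j = k ∧ a ≠ none)),
    MeasurableSpace.comap (U j a m) inferInstance

/-- `R` is a run, started at `θ₀`, of the no-stratification algorithm with deflators `lam` and
exponent `γ` on the problem `P`, driven by the streams `U`. -/
structure IsRun (P : Problem d q) (par : Params) (lam : ℕ → ℝ) (γ : ℝ)
    (θ₀ : EuclideanSpace ℝ (Fin d)) (U : ℕ → Option (Node d) → ℕ → Ω → (Fin q → ℝ))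
    (R : Trajectory Ω d) : Prop where
  init_θ : ∀ ω, R.θ 0 ω = θ₀
  init_Δ : ∀ ω, R.Δ 0 ω = par.Δ₀
  interpolates : ∀ k ω, (interpMatrix (R.θ k ω) (R.Δ k ω)).mulVec (R.β k ω) =
    fun i => R.estimate P par lam γ U k (some i) ω
  cand_mem : ∀ k ω, R.cand k ω ∈ Metric.closedBall (R.θ k ω) (R.Δ k ω)
  cand_min : ∀ k ω, IsMinOn (R.surrogate k ω) (Metric.closedBall (R.θ k ω) (R.Δ k ω)) (R.cand k ω)
  /-- ties among minimizers are broken without looking ahead -/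
  cand_adapted : ∀ k, Measurable[history U k] (R.cand k)
  step_success : ∀ k ω, R.Success P par lam γ U k ω →
    R.θ (k + 1) ω = R.cand k ω ∧ R.Δ (k + 1) ω = min (par.γup * R.Δ k ω) par.Δmax
  step_failure : ∀ k ω, ¬ R.Success P par lam γ U k ω →
    R.θ (k + 1) ω = R.θ k ω ∧ R.Δ (k + 1) ω = par.γlow * R.Δ k ω

/-- The first iteration whose incumbent is `ε`-stationary, `⊤` if there is none. -/
def hittingTime (P : Problem d q) (R : Trajectory Ω d) (ε : ℝ) (ω : Ω) : ℕ∞ :=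
  ⨅ k ∈ {k : ℕ | ‖gradient P.objective (R.θ k ω)‖ ≤ ε}, (k : ℕ∞)

open Classical in
/-- The sample complexity `W_ε`: the number of oracle calls at all evaluated points of the
iterations `0, …, T_ε`. -/
def sampleComplexity (P : Problem d q) (par : Params) (lam : ℕ → ℝ) (γ : ℝ)
    (U : ℕ → Option (Node d) → ℕ → Ω → (Fin q → ℝ)) (R : Trajectory Ω d) (ε : ℝ) (ω : Ω) :
    ℝ≥0∞ :=
  ∑' k : ℕ, if (k : ℕ∞) ≤ hittingTime P R ε ω then
    ∑ a : Option (Node d), (R.size P par lam γ U k a ω : ℝ≥0∞) else 0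

end Run

/-- The streams are independent and identically distributed, uniform on the cube. -/
structure IsUniformSampling {Ω : Type*} [MeasurableSpace Ω] (ν : Measure Ω) {d q : ℕ}
    (U : ℕ → Option (Node d) → ℕ → Ω → (Fin q → ℝ)) : Prop where
  measurable : ∀ k a m, Measurable (U k a m)
  uniform : ∀ k a m, ν.map (U k a m) = uniformCube q
  indep : iIndepFun (fun t : ℕ × Option (Node d) × ℕ => U t.1 t.2.1 t.2.2) ν

/-! ### Exponents of the stratified rates -/

/-- Exponent of `1/ε` under stratification when the gradient of the inverse map is bounded. -/
def stratExponentBounded (q : ℕ) (δ : ℝ) : ℝ := (8 * q + 4 + 2 * q * δ) / (q + 2)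

/-- Exponent of `1/ε` under stratification for sub-exponential margins with polynomial `F`, and for
sub-Gaussian margins with polynomial or exponential `F`. -/
def stratExponentPoly (q : ℕ) (δ ϱ : ℝ) : ℝ := (8 * q + 2 + (2 * δ + ϱ) * q) / (q + 1)

/-- Exponent of `1/ε` under stratification for sub-exponential margins with exponential `F`. -/
def stratExponentExp (q : ℕ) (δ κmin bmax : ℝ) : ℝ :=
  ((8 * q + 2 * δ * q + 2) * κmin - 4 * bmax) / ((q + 1) * κmin - 2 * bmax)

end SampledTrustRegion

end

open SampledTrustRegion

/-! The work is controlled path by path, without a separate bound on `T_ε`.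

Accuracy. Write `r = λ_k / (κ_as² Δ_k⁴)`. The rule with `γ = 2` forces `N ≥ r σ_min²`, and Wald's
first identity gives `E N = O(r)` at a fixed point. Wald's second identity and Chebyshev's
inequality (`measure_error_le`) then bound the probability of an error above `e Δ_k²` by a multiple
of `r / (r Δ_k²)²`, that is, of `1 / λ_k`: the radius cancels. The streams are fresh, so these
bounds carry over to the random points of the run. As `∑ k^{-(1+δ)} < ∞`, Borel-Cantelli makes all
late estimates accurate (`ae_eventually_accurate`).

Geometry. On a path with accurate late estimates, a successful step lowers `f` by a multiple of
`Δ_k²`, hence `∑ Δ_k² < ∞`. An iteration whose radius is small against the gradient succeeds, hence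
`Δ_k ≥ c ε` for all `k ≤ T_ε` (`exists_accuracy`).

Work. Let `D_k` be the running minimum of the radii. Summability gives `k D_k² ≤ A`, so `λ_k
D_k^{2+2δ} ≤ A^{1+δ}`, and the leading part of the conditional mean of `D_k^{8+2δ} N_k` is of order
`D_k⁶ / Δ_k⁴ ≤ Δ_k²`. This is summable, so `∑ D_k^{8+2δ} N_k < ∞` almost surely
(`ae_tsum_weighted_size_lt_top`). Since `D_k ≥ c ε` up to `T_ε`, dividing by the weight gives `W_ε ≤
(c ε)^{-(8+2δ)} ∑ D_k^{8+2δ} N_k`. The exponent is 4 from the sampling rule, `2 + 2δ` from the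
deflator, and 2 so that `Δ_k²` remains.

The comparison of exponents is elementary algebra. -/

namespace SampledTrustRegion

open scoped RealInnerProductSpace

/-! ### The quadratic model -/

section Model

variable {d : ℕ}

/-- The gradient of the model with coefficients `β` at its centre. -/
noncomputable def modelGrad (β : Node d → ℝ) : EuclideanSpace ℝ (Fin d) :=
  WithLp.toLp 2 fun j => β (some (Sum.inl j))

@[simp]
lemma modelGrad_apply (β : Node d → ℝ) (j : Fin d) : modelGrad β j = β (some (Sum.inl j)) := rfl

lemma model_eq (c : EuclideanSpace ℝ (Fin d)) (β : Node d → ℝ) (x : EuclideanSpace ℝ (Fin d)) :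
    model c β x = β none + ⟪modelGrad β, x - c⟫ +
      ∑ j, β (some (Sum.inr j)) * ((x j - c j) ^ 2 / 2) := by
  simp only [model, Fintype.sum_option, Fintype.sum_sum_type, basisPoly, mul_one, PiLp.inner_apply,
    modelGrad_apply, PiLp.sub_apply, RCLike.inner_apply, conj_trivial]
  simp only [mul_comm, add_assoc]

lemma model_center (c : EuclideanSpace ℝ (Fin d)) (β : Node d → ℝ) : model c β c = β none := by
  simp [model_eq]

lemma abs_quadratic_le {h : Fin d → ℝ} {H : ℝ} (hh : ∀ j, |h j| ≤ H)
    (v : EuclideanSpace ℝ (Fin d)) : |∑ j, h j * (v j ^ 2 / 2)| ≤ H / 2 * ‖v‖ ^ 2 := by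
  rw [EuclideanSpace.real_norm_sq_eq, Finset.mul_sum]
  refine (Finset.abs_sum_le_sum_abs _ _).trans (Finset.sum_le_sum fun j _ => ?_)
  rw [abs_mul, abs_of_nonneg (by positivity : (0 : ℝ) ≤ v j ^ 2 / 2)]
  nlinarith [hh j, sq_nonneg (v j)]

lemma hasGradientAt_model (c : EuclideanSpace ℝ (Fin d)) (β : Node d → ℝ) :
    HasGradientAt (model c β) (modelGrad β) c := by
  have hsum : HasFDerivAt (fun x : EuclideanSpace ℝ (Fin d) =>
      ∑ j, β (some (Sum.inr j)) * ((x j - c j) ^ 2 / 2)) (0 : _ →L[ℝ] ℝ) c := by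
    have : ∀ j, HasFDerivAt (fun x : EuclideanSpace ℝ (Fin d) =>
        β (some (Sum.inr j)) * ((x j - c j) ^ 2 / 2)) (0 : _ →L[ℝ] ℝ) c := by
      intro j
      have h1 : HasFDerivAt (fun x : EuclideanSpace ℝ (Fin d) => x j - c j)
          (EuclideanSpace.proj j : _ →L[ℝ] ℝ) c :=
        (EuclideanSpace.proj (𝕜 := ℝ) j).hasFDerivAt.sub_const _
      have h2 := ((h1.pow 2).mul_const ((1 : ℝ) / 2)).const_mul (β (some (Sum.inr j)))
      refine (h2.congr_fderiv (by simp)).congr_of_eventuallyEq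
        (Filter.Eventually.of_forall fun x => ?_)
      simp [div_eq_mul_inv]
    simpa using HasFDerivAt.fun_sum (u := Finset.univ) fun j _ => this j
  have hlin : HasFDerivAt (fun x : EuclideanSpace ℝ (Fin d) => β none + ⟪modelGrad β, x - c⟫)
      (innerSL ℝ (modelGrad β)) c := by
    have := ((innerSL ℝ (modelGrad β)).hasFDerivAt (x := c)).sub_const
      (⟪modelGrad β, c⟫)
    refine (this.const_add (β none)).congr_of_eventuallyEq (Filter.Eventually.of_forall fun x => ?_)
    simp [inner_sub_right]
  rw [hasGradientAt_iff_hasFDerivAt]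
  have := hlin.add hsum
  refine (this.congr_fderiv (add_zero _)).congr_of_eventuallyEq
    (Filter.Eventually.of_forall fun x => ?_)
  exact model_eq c β x

lemma gradient_model (c : EuclideanSpace ℝ (Fin d)) (β : Node d → ℝ) :
    gradient (model c β) c = modelGrad β := (hasGradientAt_model c β).gradient

/-- A minimizer of the model over the trust region achieves at least the Cauchy decrease. -/
lemma cauchy_decrease {c xs : EuclideanSpace ℝ (Fin d)} {β : Node d → ℝ} {Δ H : ℝ} (hΔ : 0 < Δ)
    (hH : 0 < H) (hβ : ∀ j, |β (some (Sum.inr j))| ≤ H)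
    (hmin : IsMinOn (model c β) (Metric.closedBall c Δ) xs) :
    1 / 2 * ‖modelGrad β‖ * min Δ (‖modelGrad β‖ / H) ≤ model c β c - model c β xs := by
  set g := modelGrad β with hg
  rcases eq_or_ne g 0 with h0 | h0
  · have := isMinOn_iff.1 hmin c (Metric.mem_closedBall_self hΔ.le)
    simp only [h0, norm_zero, mul_zero, zero_mul]
    linarith
  have hgpos : 0 < ‖g‖ := norm_pos_iff.2 h0
  set s := min Δ (‖g‖ / H) with hs
  have hspos : 0 < s := lt_min hΔ (by positivity)
  have hsH : s * H ≤ ‖g‖ := by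
    have : s ≤ ‖g‖ / H := min_le_right _ _
    rwa [le_div_iff₀ hH] at this
  -- Steepest descent step, with length capped by the trust region and by the point where curvature
  -- `H` would cancel the linear gain.
  set v : EuclideanSpace ℝ (Fin d) := -(s / ‖g‖) • g with hv
  have hvn : ‖v‖ = s := by
    rw [hv, norm_smul, Real.norm_eq_abs, abs_neg, abs_of_pos (by positivity)]
    field_simp
  have hle := isMinOn_iff.1 hmin (c + v) (by
    simp [Metric.mem_closedBall, hvn, hs])
  have hq := (abs_le.1 (abs_quadratic_le hβ v)).2
  have hin : ⟪g, v⟫ = -(s * ‖g‖) := by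
    rw [hv, inner_smul_right, real_inner_self_eq_norm_sq]
    field_simp
  rw [model_eq c β (c + v)] at hle
  simp only [add_sub_cancel_left, PiLp.add_apply] at hle
  rw [← hg, hin] at hle
  rw [hvn] at hq
  rw [model_center]
  nlinarith

lemma model_node_eq {c : EuclideanSpace ℝ (Fin d)} {Δ : ℝ} {β y : Node d → ℝ}
    (h : (interpMatrix c Δ).mulVec β = y) (i : Node d) : model c β (node c Δ i) = y i := by
  rw [← h]
  simp only [model, Matrix.mulVec, dotProduct, interpMatrix, Matrix.of_apply]
  exact Finset.sum_congr rfl fun j _ => mul_comm _ _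

lemma coeff_none {c : EuclideanSpace ℝ (Fin d)} {Δ : ℝ} {β y : Node d → ℝ}
    (h : (interpMatrix c Δ).mulVec β = y) : β none = y none := by
  rw [← model_center c β]; exact model_node_eq h none

lemma model_add_smul_single (c : EuclideanSpace ℝ (Fin d)) (t : ℝ) (β : Node d → ℝ) (j : Fin d) :
    model c β (c + t • EuclideanSpace.single j (1 : ℝ)) =
      β none + t * β (some (Sum.inl j)) + t ^ 2 / 2 * β (some (Sum.inr j)) := by
  rw [model_eq, add_sub_cancel_left, inner_smul_right, EuclideanSpace.inner_single_right]
  simp only [PiLp.add_apply, PiLp.smul_apply, add_sub_cancel_left, modelGrad_apply]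
  rw [Finset.sum_eq_single j]
  · simp; ring
  · intro b _ hb; simp [hb]
  · simp

/-- The interpolation conditions decouple over the coordinates, so the coefficients are central
differences. These formulas also show that the coefficients are measurable in the estimates. -/
lemma coeff_inl {c : EuclideanSpace ℝ (Fin d)} {Δ : ℝ} (hΔ : 0 < Δ) {β y : Node d → ℝ}
    (h : (interpMatrix c Δ).mulVec β = y) (j : Fin d) :
    β (some (Sum.inl j)) = (y (some (Sum.inl j)) - y (some (Sum.inr j))) / (2 * Δ) := by
  have h1 := model_node_eq h (some (Sum.inl j))
  have h2 := model_node_eq h (some (Sum.inr j))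
  simp only [node, sub_eq_add_neg, ← neg_smul] at h1 h2
  rw [model_add_smul_single] at h1 h2
  rw [← h1, ← h2]
  field_simp
  ring

lemma coeff_inr {c : EuclideanSpace ℝ (Fin d)} {Δ : ℝ} (hΔ : 0 < Δ) {β y : Node d → ℝ}
    (h : (interpMatrix c Δ).mulVec β = y) (j : Fin d) :
    β (some (Sum.inr j)) =
      (y (some (Sum.inl j)) + y (some (Sum.inr j)) - 2 * y none) / Δ ^ 2 := by
  have h0 := coeff_none h
  have h1 := model_node_eq h (some (Sum.inl j))
  have h2 := model_node_eq h (some (Sum.inr j))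
  simp only [node, sub_eq_add_neg, ← neg_smul] at h1 h2
  rw [model_add_smul_single] at h1 h2
  rw [← h1, ← h2, ← h0]
  field_simp
  ring

end Model

/-! ### Accuracy of the model -/

section Accuracy

variable {d : ℕ} {f : EuclideanSpace ℝ (Fin d) → ℝ} {L : NNReal}

/-- Mean value inequality for `f` minus its linearization on the ball of radius `‖v‖`. The constant
`L` instead of `L / 2` is harmless. -/
lemma abs_taylor_le (hf : Differentiable ℝ f) (hL : LipschitzWith L (gradient f))
    (c v : EuclideanSpace ℝ (Fin d)) : |f (c + v) - f c - ⟪gradient f c, v⟫| ≤ L * ‖v‖ ^ 2 := by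
  have key := Convex.norm_image_sub_le_of_norm_fderiv_le' (𝕜 := ℝ) (f := f) (C := L * ‖v‖)
    (s := Metric.closedBall c ‖v‖) (x := c) (y := c + v) (φ := fderiv ℝ f c)
    (fun x _ => hf x) (fun x hx => ?_) (convex_closedBall _ _)
    (Metric.mem_closedBall_self (norm_nonneg _)) (by simp)
  · have h2 : fderiv ℝ f c v = ⟪gradient f c, v⟫ := by simp [gradient]
    rw [add_sub_cancel_left, h2, Real.norm_eq_abs] at key
    linarith [sq (‖v‖), key, mul_assoc (L : ℝ) ‖v‖ ‖v‖, congrArg ((L : ℝ) * ·) (sq ‖v‖)]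
  · have h3 : ‖fderiv ℝ f x - fderiv ℝ f c‖ = ‖gradient f x - gradient f c‖ := by
      rw [gradient, gradient, ← map_sub, LinearIsometryEquiv.norm_map]
    rw [h3, ← dist_eq_norm]
    refine (hL.dist_le_mul x c).trans ?_
    gcongr
    exact hx

/-- The values `y` approximate `f` at the design points with error `e Δ²`. -/
def NodesAccurate (f : EuclideanSpace ℝ (Fin d) → ℝ) (c : EuclideanSpace ℝ (Fin d)) (Δ e : ℝ)
    (y : Node d → ℝ) : Prop := ∀ i, |y i - f (node c Δ i)| ≤ e * Δ ^ 2

lemma abs_taylor_single_le (hf : Differentiable ℝ f) (hL : LipschitzWith L (gradient f))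
    (c : EuclideanSpace ℝ (Fin d)) (t : ℝ) (j : Fin d) :
    |f (c + t • EuclideanSpace.single j (1 : ℝ)) - f c - t * gradient f c j| ≤ L * t ^ 2 := by
  have := abs_taylor_le hf hL c (t • EuclideanSpace.single j (1 : ℝ))
  rw [inner_smul_right, EuclideanSpace.inner_single_right, norm_smul] at this
  simpa using this

/-- Taylor remainders and estimation errors are both of order `Δ²`, and the central difference
divides them by `2 Δ`. -/
lemma abs_coeff_inl_sub_le (hf : Differentiable ℝ f) (hL : LipschitzWith L (gradient f))
    {c : EuclideanSpace ℝ (Fin d)} {Δ e : ℝ} (hΔ : 0 < Δ) {β y : Node d → ℝ}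
    (h : (interpMatrix c Δ).mulVec β = y) (hy : NodesAccurate f c Δ e y) (j : Fin d) :
    |β (some (Sum.inl j)) - gradient f c j| ≤ (L + e) * Δ := by
  have h1 := hy (some (Sum.inl j))
  have h2 := hy (some (Sum.inr j))
  simp only [node, sub_eq_add_neg c, ← neg_smul] at h1 h2
  have t1 := abs_taylor_single_le hf hL c Δ j
  have t2 := abs_taylor_single_le hf hL c (-Δ) j
  rw [coeff_inl hΔ h]
  rw [abs_le] at *
  have e1 : (y (some (Sum.inl j)) - y (some (Sum.inr j))) / (2 * Δ) - gradient f c j =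
      (y (some (Sum.inl j)) - y (some (Sum.inr j)) - 2 * Δ * gradient f c j) / (2 * Δ) := by
    field_simp
  rw [e1, le_div_iff₀ (by positivity), div_le_iff₀ (by positivity)]
  constructor <;> nlinarith

/-- With only a Lipschitz gradient the second difference need not approximate a second derivative.
Boundedness is all that the Cauchy decrease and the model error require. -/
lemma abs_coeff_inr_le (hf : Differentiable ℝ f) (hL : LipschitzWith L (gradient f))
    {c : EuclideanSpace ℝ (Fin d)} {Δ e : ℝ} (hΔ : 0 < Δ) {β y : Node d → ℝ}
    (h : (interpMatrix c Δ).mulVec β = y) (hy : NodesAccurate f c Δ e y) (j : Fin d) :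
    |β (some (Sum.inr j))| ≤ 2 * L + 4 * e := by
  have h0 := hy none
  have h1 := hy (some (Sum.inl j))
  have h2 := hy (some (Sum.inr j))
  simp only [node, sub_eq_add_neg c, ← neg_smul] at h0 h1 h2
  have t1 := abs_taylor_single_le hf hL c Δ j
  have t2 := abs_taylor_single_le hf hL c (-Δ) j
  rw [coeff_inr hΔ h]
  rw [abs_le] at *
  rw [le_div_iff₀ (by positivity), div_le_iff₀ (by positivity)]
  constructor <;> nlinarith

lemma norm_le_card_mul {v : EuclideanSpace ℝ (Fin d)} {B : ℝ} (hB : 0 ≤ B)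
    (hv : ∀ j, |v j| ≤ B) : ‖v‖ ≤ d * B := by
  refine (sq_le_sq₀ (norm_nonneg _) (by positivity)).1 ?_
  rw [EuclideanSpace.real_norm_sq_eq]
  calc ∑ j, v j ^ 2 ≤ ∑ _j : Fin d, B ^ 2 :=
        Finset.sum_le_sum fun j _ => sq_le_sq' (abs_le.1 (hv j)).1 (abs_le.1 (hv j)).2
    _ = d * B ^ 2 := by simp
    _ ≤ (d * B) ^ 2 := by
        rw [mul_pow]
        gcongr
        exact_mod_cast Nat.le_self_pow two_ne_zero d

lemma norm_modelGrad_sub_le (hf : Differentiable ℝ f) (hL : LipschitzWith L (gradient f))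
    {c : EuclideanSpace ℝ (Fin d)} {Δ e : ℝ} (hΔ : 0 < Δ) (he : 0 ≤ e) {β y : Node d → ℝ}
    (h : (interpMatrix c Δ).mulVec β = y) (hy : NodesAccurate f c Δ e y) :
    ‖modelGrad β - gradient f c‖ ≤ d * (L + e) * Δ := by
  rw [mul_assoc]
  exact norm_le_card_mul (by positivity) fun j => abs_coeff_inl_sub_le hf hL hΔ h hy j

/-- The four summands of the constant come from the value at the centre, the gradient error, the
quadratic term of the model and the Taylor remainder of `f`. -/
lemma abs_model_sub_le (hf : Differentiable ℝ f) (hL : LipschitzWith L (gradient f))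
    {c x : EuclideanSpace ℝ (Fin d)} {Δ e : ℝ} (hΔ : 0 < Δ) (he : 0 ≤ e) {β y : Node d → ℝ}
    (h : (interpMatrix c Δ).mulVec β = y) (hy : NodesAccurate f c Δ e y)
    (hx : x ∈ Metric.closedBall c Δ) :
    |model c β x - f x| ≤ (e + d * (L + e) + (L + 2 * e) + L) * Δ ^ 2 := by
  obtain ⟨v, rfl⟩ : ∃ v, x = c + v := ⟨x - c, by simp⟩
  have hv : ‖v‖ ≤ Δ := by simpa using hx
  have hv2 : ‖v‖ ^ 2 ≤ Δ ^ 2 := by gcongr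
  have h0 : |β none - f c| ≤ e * Δ ^ 2 := by rw [coeff_none h]; exact hy none
  have h1 : |⟪modelGrad β - gradient f c, v⟫| ≤ d * (L + e) * Δ * Δ :=
    (abs_real_inner_le_norm _ _).trans (mul_le_mul (norm_modelGrad_sub_le hf hL hΔ he h hy) hv
      (norm_nonneg _) (by positivity))
  have h2 : |∑ j, β (some (Sum.inr j)) * (v j ^ 2 / 2)| ≤ (L + 2 * e) * Δ ^ 2 := by
    refine (abs_quadratic_le (abs_coeff_inr_le hf hL hΔ h hy) v).trans ?_
    have : (0 : ℝ) ≤ L := L.2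
    nlinarith
  have h3 : |f (c + v) - f c - ⟪gradient f c, v⟫| ≤ L * Δ ^ 2 :=
    (abs_taylor_le hf hL c v).trans (by gcongr)
  rw [model_eq]
  simp only [add_sub_cancel_left, PiLp.add_apply]
  rw [inner_sub_left] at h1
  rw [abs_le] at *
  constructor <;> nlinarith

end Accuracy

/-! ### One iteration with accurate estimates -/

section Step

variable {d : ℕ} {f : EuclideanSpace ℝ (Fin d) → ℝ} {L : NNReal}

/-- With accurate estimates, an iteration whose radius is small compared with the gradient is
successful. -/
lemma exists_success_threshold (hf : Differentiable ℝ f) (hL : LipschitzWith L (gradient f))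
    {η ηT : ℝ} (hη : η < 1) (hηT : 0 < ηT) :
    ∃ τ : ℝ, 0 < τ ∧ ∀ (c xs : EuclideanSpace ℝ (Fin d)) (Δ e ys : ℝ) (β y : Node d → ℝ),
      0 < Δ → 0 ≤ e → e ≤ 1 → (interpMatrix c Δ).mulVec β = y → NodesAccurate f c Δ e y →
      xs ∈ Metric.closedBall c Δ → IsMinOn (model c β) (Metric.closedBall c Δ) xs →
      |ys - f xs| ≤ e * Δ ^ 2 → Δ ≤ τ * ‖gradient f c‖ →
      η ≤ (y none - ys) / (model c β c - model c β xs) ∧ Δ ≤ ηT * ‖modelGrad β‖ := by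
  set H : ℝ := 2 * L + 4 with hH
  set κf : ℝ := 4 + d * (L + 1) + 2 * L with hκf
  set κg : ℝ := d * (L + 1) with hκg
  have hL0 : (0 : ℝ) ≤ L := L.2
  have hHpos : 0 < H := by positivity
  have hκfpos : 0 < κf := by positivity
  have hκg0 : 0 ≤ κg := by positivity
  -- The three entries give, in order: the Cauchy step reaches the boundary, the errors are below `1
  -- - η` times the decrease, and the gradient test holds.
  set τ₀ : ℝ := min (1 / H) (min ((1 - η) / (2 * κf)) ηT) with hτ₀
  have hη' : 0 < 1 - η := by linarith
  have hτ₀pos : 0 < τ₀ := by positivity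
  -- The denominator absorbs the gradient error `κg Δ`, turning a bound by the true gradient into `Δ
  -- ≤ τ₀ ‖g‖` for the model gradient.
  refine ⟨τ₀ / (1 + τ₀ * κg), by positivity, ?_⟩
  intro c xs Δ e ys β y hΔ he he1 h hy hxs hmin hys hΔτ
  set g := modelGrad β with hg
  have hgrad : ‖g - gradient f c‖ ≤ κg * Δ :=
    (norm_modelGrad_sub_le hf hL hΔ he h hy).trans (by rw [hκg]; gcongr)
  have hnorm : ‖gradient f c‖ ≤ ‖g‖ + κg * Δ := by
    have := norm_sub_norm_le (gradient f c) g
    rw [norm_sub_rev] at this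
    linarith
  have hΔg : Δ ≤ τ₀ * ‖g‖ := by
    rw [div_mul_eq_mul_div, le_div_iff₀ (by positivity)] at hΔτ
    nlinarith [mul_le_mul_of_nonneg_left hnorm hτ₀pos.le]
  have hgpos : 0 < ‖g‖ := by
    by_contra hn
    nlinarith [norm_nonneg g]
  have ha : Δ * H ≤ ‖g‖ := by
    have h1 : τ₀ ≤ 1 / H := min_le_left _ _
    have h2 : Δ ≤ 1 / H * ‖g‖ := hΔg.trans (by gcongr)
    rwa [one_div, inv_mul_eq_div, le_div_iff₀ hHpos] at h2
  have hb : Δ * (2 * κf) ≤ (1 - η) * ‖g‖ := by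
    have h1 : τ₀ ≤ (1 - η) / (2 * κf) := (min_le_right _ _).trans (min_le_left _ _)
    have h2 : Δ ≤ (1 - η) / (2 * κf) * ‖g‖ := hΔg.trans (by gcongr)
    rwa [div_mul_eq_mul_div, le_div_iff₀ (by positivity)] at h2
  have hc : Δ ≤ ηT * ‖g‖ := hΔg.trans (by
    gcongr; exact (min_le_right _ _).trans (min_le_right _ _))
  refine ⟨?_, hc⟩
  have hdec := cauchy_decrease hΔ hHpos (fun j =>
    (abs_coeff_inr_le hf hL hΔ h hy j).trans (by rw [hH]; linarith)) hmin
  rw [← hg, min_eq_left ((le_div_iff₀ hHpos).2 ha)] at hdec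
  have hm := abs_model_sub_le hf hL hΔ he h hy hxs
  -- The model is exact on the estimate at the centre, so `1 - ρ` equals `ys` minus the model value
  -- at `xs`, divided by the model decrease. Only the error at the candidate has to be bounded.
  have hcen : model c β c = y none := by rw [model_center, coeff_none h]
  have hκ : (e + d * (L + e) + (L + 2 * e) + L) + e ≤ κf := by
    have : (d : ℝ) * (L + e) ≤ d * (L + 1) := by gcongr
    rw [hκf]; linarith
  have hκ2 : (e + d * (L + e) + (L + 2 * e) + L) * Δ ^ 2 + e * Δ ^ 2 ≤ κf * Δ ^ 2 := by
    rw [← add_mul]; gcongr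
  have hκ3 : κf * Δ ^ 2 ≤ (1 - η) * (1 / 2 * ‖g‖ * Δ) := by nlinarith
  have hpos : 0 < model c β c - model c β xs := lt_of_lt_of_le (by positivity) hdec
  rw [le_div_iff₀ hpos]
  have hfin : (1 - η) * (1 / 2 * ‖g‖ * Δ) ≤ (1 - η) * (model c β c - model c β xs) := by gcongr
  rw [abs_le] at hm hys
  linarith

/-- A successful iteration with accurate estimates decreases the objective. -/
lemma exists_decrease_constant (hf : Differentiable ℝ f) (hL : LipschitzWith L (gradient f))
    {η ηT : ℝ} (hη : 0 < η) (hηT : 0 < ηT) :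
    ∃ κ : ℝ, 0 < κ ∧ ∀ (c xs : EuclideanSpace ℝ (Fin d)) (Δ e ys : ℝ) (β y : Node d → ℝ),
      0 < Δ → e ≤ 1 → (interpMatrix c Δ).mulVec β = y → NodesAccurate f c Δ e y →
      IsMinOn (model c β) (Metric.closedBall c Δ) xs → |ys - f xs| ≤ e * Δ ^ 2 →
      η ≤ (y none - ys) / (model c β c - model c β xs) → Δ ≤ ηT * ‖modelGrad β‖ →
      f xs ≤ f c - (κ - 2 * e) * Δ ^ 2 := by
  set H : ℝ := 2 * L + 4 with hH
  have hL0 : (0 : ℝ) ≤ L := L.2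
  have hHpos : 0 < H := by positivity
  refine ⟨η * (1 / 2 * ηT⁻¹ * min 1 (ηT⁻¹ / H)), by positivity, ?_⟩
  intro c xs Δ e ys β y hΔ he1 h hy hmin hys hρ hΔg
  have hdec := cauchy_decrease hΔ hHpos (fun j =>
    (abs_coeff_inr_le hf hL hΔ h hy j).trans (by rw [hH]; linarith)) hmin
  -- The gradient test makes the model gradient at least proportional to `Δ`, so the Cauchy decrease
  -- is of order `Δ²`.
  have hg : ηT⁻¹ * Δ ≤ ‖modelGrad β‖ := by
    rw [inv_mul_le_iff₀ hηT]; exact hΔg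
  have h1 : (1 / 2 * ηT⁻¹ * min 1 (ηT⁻¹ / H)) * Δ ^ 2 ≤
      1 / 2 * ‖modelGrad β‖ * min Δ (‖modelGrad β‖ / H) := by
    calc (1 / 2 * ηT⁻¹ * min 1 (ηT⁻¹ / H)) * Δ ^ 2
        = 1 / 2 * (ηT⁻¹ * Δ) * (min 1 (ηT⁻¹ / H) * Δ) := by ring
      _ = 1 / 2 * (ηT⁻¹ * Δ) * min Δ (ηT⁻¹ * Δ / H) := by
          rw [min_mul_of_nonneg _ _ hΔ.le, one_mul,
            show ηT⁻¹ / H * Δ = ηT⁻¹ * Δ / H by ring]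
      _ ≤ _ := by gcongr
  have hDpos : 0 < model c β c - model c β xs := by
    refine lt_of_lt_of_le ?_ (h1.trans hdec)
    positivity
  rw [le_div_iff₀ hDpos] at hρ
  have h2 := mul_le_mul_of_nonneg_left (h1.trans hdec) hη.le
  have h0 := hy none
  simp only [node] at h0
  rw [abs_le] at h0 hys
  nlinarith

end Step

/-! ### Radii along a run -/

section Radii

variable {Δ : ℕ → ℝ} {S : ℕ → Prop} {γup γlow : ℝ} {K : ℕ}

/-- The squared radii are summable if successful iterations decrease a function that is bounded
below by a multiple of the squared radius. -/
lemma summable_sq_radius {φ : ℕ → ℝ} {κ m : ℝ} (hΔ : ∀ k, 0 < Δ k) (hup : 1 < γup)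
    (hlow : 0 < γlow) (hlow1 : γlow < 1) (hκ : 0 < κ) (hφ : ∀ k, m ≤ φ k)
    (hs : ∀ k, K ≤ k → S k → Δ (k + 1) ≤ γup * Δ k ∧ φ (k + 1) ≤ φ k - κ * Δ k ^ 2)
    (hu : ∀ k, K ≤ k → ¬ S k → Δ (k + 1) = γlow * Δ k ∧ φ (k + 1) = φ k) :
    Summable fun k => Δ k ^ 2 := by
  -- Lyapunov function `φ + b Δ²`: with this `b`, expanding the radius costs at most half of the
  -- decrease of `φ`, while a failure gains `b (1 - γlow²) Δ²` from shrinking.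
  set b : ℝ := κ / (2 * γup ^ 2) with hb
  have hb0 : 0 < b := by positivity
  have hbκ : b * γup ^ 2 = κ / 2 := by rw [hb]; field_simp
  have hl2 : 0 < 1 - γlow ^ 2 := by nlinarith
  set c : ℝ := min (κ / 2) (b * (1 - γlow ^ 2)) with hc
  have hc0 : 0 < c := by positivity
  have hstep : ∀ k, K ≤ k →
      φ (k + 1) + b * Δ (k + 1) ^ 2 ≤ φ k + b * Δ k ^ 2 - c * Δ k ^ 2 := by
    intro k hk
    have hk0 : 0 ≤ Δ k ^ 2 := sq_nonneg _
    by_cases hS : S k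
    · obtain ⟨h1, h2⟩ := hs k hk hS
      have h3 : Δ (k + 1) ^ 2 ≤ γup ^ 2 * Δ k ^ 2 := by
        rw [← mul_pow]; exact pow_le_pow_left₀ (hΔ _).le h1 2
      have h4 : b * Δ (k + 1) ^ 2 ≤ κ / 2 * Δ k ^ 2 := by
        calc b * Δ (k + 1) ^ 2 ≤ b * (γup ^ 2 * Δ k ^ 2) := by gcongr
          _ = _ := by rw [← mul_assoc, hbκ]
      have h5 : c * Δ k ^ 2 ≤ κ / 2 * Δ k ^ 2 := by gcongr; exact min_le_left _ _
      have h6 : 0 ≤ b * Δ k ^ 2 := by positivity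
      linarith
    · obtain ⟨h1, h2⟩ := hu k hk hS
      have h5 : c * Δ k ^ 2 ≤ b * (1 - γlow ^ 2) * Δ k ^ 2 := by gcongr; exact min_le_right _ _
      rw [h1, h2, mul_pow]
      linarith
  rw [← summable_nat_add_iff K]
  refine summable_of_sum_range_le (c := (φ K + b * Δ K ^ 2 - m) / c) (fun _ => sq_nonneg _) ?_
  intro n
  have hind : c * ∑ i ∈ Finset.range n, Δ (i + K) ^ 2 ≤
      φ K + b * Δ K ^ 2 - (φ (n + K) + b * Δ (n + K) ^ 2) := by
    induction n with
    | zero => simp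
    | succ n ih =>
      rw [Finset.sum_range_succ, mul_add]
      have := hstep (n + K) (Nat.le_add_left _ _)
      rw [show n + 1 + K = n + K + 1 by ring]
      linarith
  rw [le_div_iff₀ hc0, mul_comm]
  have := hφ (n + K)
  have : 0 ≤ b * Δ (n + K) ^ 2 := by positivity
  linarith

/-- Before the first `ε`-stationary incumbent, the radii are at least a multiple of `ε`. -/
lemma exists_radius_lower_bound {G : ℕ → ℝ} {τ Δmax : ℝ} (hΔ : ∀ k, 0 < Δ k) (hup : 1 < γup)
    (hlow : 0 < γlow) (hτ : 0 < τ) (hmax : 0 < Δmax)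
    (hG : ∀ k, K ≤ k → Δ k ≤ τ * G k → S k)
    (hs : ∀ k, S k → Δ (k + 1) = min (γup * Δ k) Δmax)
    (hu : ∀ k, ¬ S k → Δ (k + 1) = γlow * Δ k) :
    ∃ c : ℝ, 0 < c ∧ ∀ ε : ℝ, 0 < ε → ε ≤ 1 → ∀ k, (∀ j < k, ε < G j) → c * ε ≤ Δ k := by
  -- Nothing is known about success before `K`, so these finitely many radii enter the constant
  -- through their minimum.
  obtain ⟨j₀, -, hj₀⟩ := Finset.exists_min_image (Finset.range (K + 1)) Δ ⟨0, by simp⟩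
  set c : ℝ := min (Δ j₀) (min (γlow * τ) Δmax) with hc
  have hc0 : 0 < c := lt_min (hΔ _) (lt_min (by positivity) hmax)
  refine ⟨c, hc0, fun ε hε hε1 k => ?_⟩
  have hcε : c * ε ≤ c := mul_le_of_le_one_right hc0.le hε1
  induction k with
  | zero => exact fun _ => hcε.trans ((min_le_left _ _).trans (hj₀ 0 (by simp)))
  | succ k ih =>
    intro hk
    have ih' := ih fun j hj => hk j (hj.trans (Nat.lt_succ_self _))
    rcases Nat.lt_or_ge k K with hkK | hkK
    · exact hcε.trans ((min_le_left _ _).trans (hj₀ (k + 1) (by simpa using hkK)))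
    by_cases hS : S k
    · rw [hs k hS]
      refine le_min (ih'.trans ?_) (hcε.trans ((min_le_right _ _).trans (min_le_right _ _)))
      nlinarith [hΔ k]
    · rw [hu k hS]
      -- A late failure only occurs at a radius above `τ ε`, so one shrinkage leaves at least `γlow
      -- τ ε`.
      have h1 : τ * G k < Δ k := not_le.1 fun h => hS (hG k hkK h)
      have h2 : τ * ε ≤ Δ k := (mul_le_mul_of_nonneg_left (hk k (Nat.lt_succ_self _)).le hτ.le).trans
        h1.le
      calc c * ε ≤ γlow * τ * ε := by
            gcongr; exact (min_le_right _ _).trans (min_le_left _ _)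
        _ = γlow * (τ * ε) := mul_assoc _ _ _
        _ ≤ _ := by gcongr

end Radii

/-! ### Wald's identities -/

section Wald

variable {Ω : Type*} {y : ℕ → Ω → ℝ} {I : ℕ → Ω → ℝ} {μ v : ℝ}

/-- The σ-algebra generated by the first `m` variables. -/
@[reducible]
def pastSigma (y : ℕ → Ω → ℝ) (m : ℕ) : MeasurableSpace Ω :=
  ⨆ i ∈ {i : ℕ | i < m}, MeasurableSpace.comap (y i) inferInstance

lemma measurable_pastSigma {i m : ℕ} (h : i < m) : Measurable[pastSigma y m] (y i) :=
  measurable_iff_comap_le.2 (le_iSup₂_of_le (f := fun i (_ : i ∈ {i : ℕ | i < m}) =>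
    MeasurableSpace.comap (y i) inferInstance) i h le_rfl)

lemma pastSigma_mono {m n : ℕ} (h : m ≤ n) : pastSigma y m ≤ pastSigma y n :=
  iSup₂_le fun _ hi => measurable_iff_comap_le.1 (measurable_pastSigma (lt_of_lt_of_le hi h))

variable [mΩ : MeasurableSpace Ω] {ν : Measure Ω}

lemma pastSigma_le (hy : ∀ m, Measurable (y m)) (m : ℕ) : pastSigma y m ≤ mΩ :=
  iSup₂_le fun _ _ => (hy _).comap_le

lemma indepFun_of_pastSigma (hy : ∀ m, Measurable (y m)) (hind : iIndepFun y ν) {m : ℕ}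
    {X : Ω → ℝ} (hX : Measurable[pastSigma y m] X) : IndepFun X (y m) ν := by
  have h := indep_iSup_of_disjoint (fun i => (hy i).comap_le) hind
    (S := {i : ℕ | i < m}) (T := {m}) (by simp)
  simp only [Set.mem_singleton_iff, iSup_iSup_eq_left] at h
  exact indep_of_indep_of_le_left h (measurable_iff_comap_le.1 hX)

/-- Whether observation `m` is drawn is decided by the earlier ones, hence independently of its
value. -/
lemma integral_indicator_mul_sq (hy : ∀ m, Measurable (y m)) (hind : iIndepFun y ν)
    (hvar : ∀ m, ∫ ω, (y m ω - μ) ^ 2 ∂ν = v)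
    (hI : ∀ m, Measurable[pastSigma y m] (I m)) (m : ℕ) :
    ∫ ω, I m ω * (y m ω - μ) ^ 2 ∂ν = v * ∫ ω, I m ω ∂ν := by
  have hI' : Measurable (I m) := (hI m).mono (pastSigma_le hy m) le_rfl
  have hi : IndepFun (I m) (fun ω => (y m ω - μ) ^ 2) ν :=
    (indepFun_of_pastSigma hy hind (hI m)).comp (φ := id) (ψ := fun x => (x - μ) ^ 2)
      measurable_id (by fun_prop)
  rw [hi.integral_fun_mul_eq_mul_integral hI'.aestronglyMeasurable
    (((hy m).sub_const μ).pow_const 2).aestronglyMeasurable, hvar, mul_comm]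

variable [IsProbabilityMeasure ν]

lemma memLp_indicator_mul (hy : ∀ m, Measurable (y m)) (h2 : ∀ m, MemLp (y m) 2 ν)
    (hI : ∀ m, Measurable[pastSigma y m] (I m)) (hI01 : ∀ m ω, I m ω = 0 ∨ I m ω = 1) (m : ℕ) :
    MemLp (fun ω => I m ω * (y m ω - μ)) 2 ν := by
  have hI' : Measurable (I m) := (hI m).mono (pastSigma_le hy m) le_rfl
  refine ((h2 m).sub (memLp_const μ)).mono
    (hI'.mul ((hy m).sub_const μ)).aestronglyMeasurable (Filter.Eventually.of_forall fun ω => ?_)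
  rcases hI01 m ω with h | h <;> simp [h]

lemma integrable_indicator_mul_sq (hy : ∀ m, Measurable (y m)) (h2 : ∀ m, MemLp (y m) 2 ν)
    (hI : ∀ m, Measurable[pastSigma y m] (I m)) (hI01 : ∀ m ω, I m ω = 0 ∨ I m ω = 1) (m : ℕ) :
    Integrable (fun ω => I m ω * (y m ω - μ) ^ 2) ν := by
  refine (memLp_indicator_mul (μ := μ) hy h2 hI hI01 m).integrable_sq.congr
    (Filter.Eventually.of_forall fun ω => ?_)
  rcases hI01 m ω with h | h <;> simp [h]

lemma integrable_indicator (hy : ∀ m, Measurable (y m))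
    (hI : ∀ m, Measurable[pastSigma y m] (I m)) (hI01 : ∀ m ω, I m ω = 0 ∨ I m ω = 1) (m : ℕ) :
    Integrable (I m) ν := by
  have hI' : Measurable (I m) := (hI m).mono (pastSigma_le hy m) le_rfl
  refine Integrable.of_bound hI'.aestronglyMeasurable 1 (Filter.Eventually.of_forall fun ω => ?_)
  rcases hI01 m ω with h | h <;> simp [h]

/-- Wald's first identity, for the squares. -/
lemma wald_sum_sq (hy : ∀ m, Measurable (y m)) (hind : iIndepFun y ν)
    (h2 : ∀ m, MemLp (y m) 2 ν) (hvar : ∀ m, ∫ ω, (y m ω - μ) ^ 2 ∂ν = v)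
    (hI : ∀ m, Measurable[pastSigma y m] (I m)) (hI01 : ∀ m ω, I m ω = 0 ∨ I m ω = 1) (t : ℕ) :
    ∫ ω, ∑ m ∈ Finset.range t, I m ω * (y m ω - μ) ^ 2 ∂ν =
      v * ∫ ω, ∑ m ∈ Finset.range t, I m ω ∂ν := by
  rw [integral_finsetSum _ fun m _ => integrable_indicator_mul_sq hy h2 hI hI01 m,
    integral_finsetSum _ fun m _ => integrable_indicator hy hI hI01 m, Finset.mul_sum]
  exact Finset.sum_congr rfl fun m _ => integral_indicator_mul_sq hy hind hvar hI m

/-- Wald's second identity. -/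
lemma wald_sq_sum (hy : ∀ m, Measurable (y m)) (hind : iIndepFun y ν)
    (h2 : ∀ m, MemLp (y m) 2 ν) (hmean : ∀ m, ∫ ω, y m ω ∂ν = μ)
    (hvar : ∀ m, ∫ ω, (y m ω - μ) ^ 2 ∂ν = v)
    (hI : ∀ m, Measurable[pastSigma y m] (I m)) (hI01 : ∀ m ω, I m ω = 0 ∨ I m ω = 1) (t : ℕ) :
    ∫ ω, (∑ m ∈ Finset.range t, I m ω * (y m ω - μ)) ^ 2 ∂ν =
      v * ∫ ω, ∑ m ∈ Finset.range t, I m ω ∂ν := by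
  induction t with
  | zero => simp
  | succ t ih =>
    set X : Ω → ℝ := fun ω => ∑ m ∈ Finset.range t, I m ω * (y m ω - μ) with hX
    have hXm : Measurable[pastSigma y t] X := by
      refine Finset.measurable_fun_sum _ fun m hm => ?_
      have hmt := Finset.mem_range.1 hm
      exact ((hI m).mono (pastSigma_mono hmt.le) le_rfl).mul
        ((measurable_pastSigma hmt).sub_const μ)
    have hX2 : MemLp X 2 ν := memLp_finsetSum _ fun m _ => memLp_indicator_mul hy h2 hI hI01 m
    have hYm := memLp_indicator_mul (μ := μ) hy h2 hI hI01 t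
    -- Orthogonality of martingale increments: `X * I t` depends on the past of `t`, and `y t - μ`
    -- is centred and independent of that past.
    have hcross : ∫ ω, X ω * (I t ω * (y t ω - μ)) ∂ν = 0 := by
      have hXI : Measurable[pastSigma y t] fun ω => X ω * I t ω := hXm.mul (hI t)
      have hi : IndepFun (fun ω => X ω * I t ω) (fun ω => y t ω - μ) ν :=
        (indepFun_of_pastSigma hy hind hXI).comp (φ := id) (ψ := fun x => x - μ)
          measurable_id (by fun_prop)
      have h0 : ∫ ω, (y t ω - μ) ∂ν = 0 := by
        rw [integral_sub ((h2 t).integrable (by norm_num)) (integrable_const _), hmean]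
        simp
      simp_rw [← mul_assoc]
      rw [hi.integral_fun_mul_eq_mul_integral
        (hXI.mono (pastSigma_le hy t) le_rfl).aestronglyMeasurable
        ((hy t).sub_const μ).aestronglyMeasurable, h0, mul_zero]
    have hexp : ∀ ω, (∑ m ∈ Finset.range (t + 1), I m ω * (y m ω - μ)) ^ 2 =
        X ω ^ 2 + 2 * (X ω * (I t ω * (y t ω - μ))) + I t ω * (y t ω - μ) ^ 2 := by
      intro ω
      rw [Finset.sum_range_succ]
      rcases hI01 t ω with h | h <;> simp only [h, hX] <;> ring
    have hi2 : Integrable (fun ω => 2 * (X ω * (I t ω * (y t ω - μ)))) ν :=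
      (hX2.integrable_mul hYm).const_mul 2
    have hi3 : Integrable (fun ω => X ω ^ 2 + 2 * (X ω * (I t ω * (y t ω - μ)))) ν :=
      hX2.integrable_sq.add hi2
    simp_rw [hexp]
    rw [integral_add hi3 (integrable_indicator_mul_sq hy h2 hI hI01 t),
      integral_add hX2.integrable_sq hi2, integral_const_mul, hcross, ih,
      integral_indicator_mul_sq hy hind hvar hI]
    simp_rw [Finset.sum_range_succ]
    rw [integral_add (integrable_finsetSum _ fun m _ => integrable_indicator hy hI hI01 m)
      (integrable_indicator hy hI hI01 t)]
    ring

end Wald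

/-! ### The adaptive sample size -/

section SampleSize

lemma measurable_sampleMean_apply {Ω : Type*} [MeasurableSpace Ω] {y : ℕ → Ω → ℝ} {n : ℕ}
    (h : ∀ i < n, Measurable (y i)) : Measurable fun ω => sampleMean (fun m => y m ω) n :=
  (Finset.measurable_fun_sum _ fun i hi => h i (Finset.mem_range.1 hi)).div_const _

lemma measurable_sampleVar_apply {Ω : Type*} [MeasurableSpace Ω] {y : ℕ → Ω → ℝ} {n : ℕ}
    (h : ∀ i < n, Measurable (y i)) : Measurable fun ω => sampleVar (fun m => y m ω) n :=
  (Finset.measurable_fun_sum _ fun i hi =>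
    ((h i (Finset.mem_range.1 hi)).sub (measurable_sampleMean_apply h)).pow_const 2).div_const _

lemma measurableSet_mem_acceptedSizes {Ω : Type*} [MeasurableSpace Ω] (par : Params) (lam γ : ℝ)
    {Δ : Ω → ℝ} (hΔ : Measurable Δ) {y : ℕ → Ω → ℝ} {n : ℕ} (h : ∀ i < n, Measurable (y i)) :
    MeasurableSet {ω | n ∈ acceptedSizes par lam γ (Δ ω) (fun m => y m ω)} := by
  refine (MeasurableSet.const _).inter ((MeasurableSet.const _).inter ?_)
  have h1 : Measurable fun ω => truncVar par (fun m => y m ω) n :=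
    ((measurable_const (a := par.σminSq)).max (measurable_sampleVar_apply h)).const_mul _
  have h2 : Measurable fun ω => √lam * √(truncVar par (fun m => y m ω) n) := h1.sqrt.const_mul _
  exact measurableSet_le h2 ((hΔ.pow_const γ).const_mul _)

variable (par : Params) {lam γ Δ μ : ℝ} {y : ℕ → ℝ} {m n : ℕ}

/-- Acceptance of `n` involves only the first `n` observations, so this form exhibits the sample
size as a stopping time. -/
lemma lt_sampleSize_iff :
    (m : ℕ∞) < sampleSize par lam γ Δ y ↔ ∀ n ≤ m, n ∉ acceptedSizes par lam γ Δ y := by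
  rw [← ENat.add_one_le_iff (ENat.natCast_ne_top m), sampleSize, le_iInf₂_iff]
  constructor
  · intro h n hn hA
    have := h n hA
    norm_cast at this
    omega
  · intro h n hA
    by_contra hlt
    refine h n ?_ hA
    norm_cast at hlt
    omega

lemma mem_acceptedSizes_of_sampleSize_eq (h : sampleSize par lam γ Δ y = n) :
    n ∈ acceptedSizes par lam γ Δ y := by
  by_contra hn
  have h1 : ¬ (n : ℕ∞) < sampleSize par lam γ Δ y := by rw [h]; exact lt_irrefl _
  rw [lt_sampleSize_iff] at h1
  push Not at h1
  obtain ⟨k, hk, hkA⟩ := h1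
  rcases hk.lt_or_eq with hk | rfl
  · have h2 : (k : ℕ∞) < sampleSize par lam γ Δ y := by rw [h]; exact_mod_cast hk
    exact (lt_sampleSize_iff par).1 h2 k le_rfl hkA
  · exact hn hkA

lemma sum_sub_sampleMean_sq_le (y : ℕ → ℝ) (n : ℕ) (μ : ℝ) :
    ∑ m ∈ Finset.range n, (y m - sampleMean y n) ^ 2 ≤
      ∑ m ∈ Finset.range n, (y m - μ) ^ 2 := by
  rcases Nat.eq_zero_or_pos n with rfl | hn
  · simp
  have hn' : (n : ℝ) ≠ 0 := by positivity
  set a := sampleMean y n with ha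
  have hs : ∑ m ∈ Finset.range n, y m = n * a := by rw [ha, sampleMean]; field_simp
  have h1 : ∑ m ∈ Finset.range n, (y m - μ) ^ 2 =
      ∑ m ∈ Finset.range n, (y m - a) ^ 2 + n * (a - μ) ^ 2 := by
    have : ∀ m, (y m - μ) ^ 2 = (y m - a) ^ 2 + (2 * (a - μ) * y m + (μ ^ 2 - a ^ 2)) := by
      intro m; ring
    simp_rw [this]
    rw [Finset.sum_add_distrib, Finset.sum_add_distrib, ← Finset.mul_sum, hs]
    simp
    ring
  rw [h1]
  have : 0 ≤ n * (a - μ) ^ 2 := by positivity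
  linarith

/-- The ratio of the deflator and the squared threshold of the sampling rule. -/
noncomputable def samplingRate (par : Params) (lam γ Δ : ℝ) : ℝ := lam / (par.κas * Δ ^ γ) ^ 2

/-- The least sample size that is free of the sample variance. -/
noncomputable def baseSize (par : Params) (lam γ Δ : ℝ) : ℝ :=
  par.n₀ + lam + samplingRate par lam γ Δ * par.σminSq + 2

lemma samplingRate_nonneg (hlam : 0 ≤ lam) : 0 ≤ samplingRate par lam γ Δ := by
  unfold samplingRate; positivity

lemma two_le_baseSize (hlam : 0 ≤ lam) : 2 ≤ baseSize par lam γ Δ := by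
  have := samplingRate_nonneg par (γ := γ) (Δ := Δ) hlam
  have := par.σminSq_pos
  unfold baseSize
  have : 0 ≤ samplingRate par lam γ Δ * par.σminSq := by positivity
  have : (0 : ℝ) ≤ par.n₀ := Nat.cast_nonneg _
  linarith

lemma rule_iff (hlam : 0 ≤ lam) (hΔ : 0 < Δ) (hn : 0 < n) :
    √lam * √(truncVar par y n) ≤ par.κas * Δ ^ γ ↔
      samplingRate par lam γ Δ * max par.σminSq (sampleVar y n) ≤ n := by
  have hr : 0 < par.κas * Δ ^ γ := mul_pos par.κas_pos (Real.rpow_pos_of_pos hΔ _)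
  have hn' : (0 : ℝ) < n := by exact_mod_cast hn
  set M := max par.σminSq (sampleVar y n)
  have e1 : lam * (1 / (n : ℝ) * M) = lam * M / n := by ring
  have e2 : lam / (par.κas * Δ ^ γ) ^ 2 * M = lam * M / (par.κas * Δ ^ γ) ^ 2 := by ring
  rw [← Real.sqrt_mul hlam, Real.sqrt_le_left hr.le, truncVar, samplingRate, e1, e2,
    div_le_iff₀ hn', div_le_iff₀ (by positivity), mul_comm (n : ℝ)]

lemma pos_of_mem_acceptedSizes (h : n ∈ acceptedSizes par lam γ Δ y) : 0 < n :=
  lt_of_lt_of_le par.one_le_n₀ h.1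

/-- The truncation at `σminSq` yields a deterministic lower bound on the sample size, which drives
the Chebyshev estimate. -/
lemma le_of_mem_acceptedSizes (hlam : 0 ≤ lam) (hΔ : 0 < Δ)
    (h : n ∈ acceptedSizes par lam γ Δ y) : samplingRate par lam γ Δ * par.σminSq ≤ n := by
  refine le_trans ?_ ((rule_iff par hlam hΔ (pos_of_mem_acceptedSizes par h)).1 h.2.2)
  gcongr
  · exact samplingRate_nonneg par hlam
  · exact le_max_left _ _

/-- Above the base size only the sample variance can cause a rejection, which means that `n (n - 1)`
is less than `r` times the sum of squared deviations. The summand 2 in `baseSize` ensures `n > 2`,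
so that `n² ≤ 2 n (n - 1)`. -/
lemma sq_le_of_notMem_acceptedSizes (hlam : 0 ≤ lam) (hΔ : 0 < Δ)
    (h : n ∉ acceptedSizes par lam γ Δ y) :
    (n : ℝ) ^ 2 ≤ baseSize par lam γ Δ ^ 2 +
      2 * samplingRate par lam γ Δ * ∑ m ∈ Finset.range n, (y m - μ) ^ 2 := by
  set r := samplingRate par lam γ Δ with hr
  have hr0 : 0 ≤ r := samplingRate_nonneg par hlam
  have hb := two_le_baseSize par (γ := γ) (Δ := Δ) hlam
  have hQ : 0 ≤ ∑ m ∈ Finset.range n, (y m - μ) ^ 2 := Finset.sum_nonneg fun _ _ => sq_nonneg _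
  by_cases hnb : (n : ℝ) ≤ baseSize par lam γ Δ
  · have h1 : (n : ℝ) ^ 2 ≤ baseSize par lam γ Δ ^ 2 := by gcongr
    have h2 : 0 ≤ 2 * r * ∑ m ∈ Finset.range n, (y m - μ) ^ 2 := by positivity
    linarith
  push Not at hnb
  have hσ : 0 ≤ r * par.σminSq := mul_nonneg hr0 par.σminSq_pos.le
  have hn0 : (0 : ℝ) ≤ par.n₀ := Nat.cast_nonneg _
  rw [baseSize, ← hr] at hnb
  have hn2 : (2 : ℝ) < n := by linarith
  have hnpos : 0 < n := by
    have : (0 : ℝ) < n := by linarith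
    exact_mod_cast this
  have hrule : ¬ (r * max par.σminSq (sampleVar y n) ≤ n) := by
    intro hrule
    refine h ⟨?_, ?_, (rule_iff par hlam hΔ hnpos).2 hrule⟩
    · have : (par.n₀ : ℝ) ≤ n := by linarith
      exact_mod_cast this
    · linarith
  have hv : (n : ℝ) < r * sampleVar y n := by
    by_contra hv
    refine hrule ?_
    rcases max_cases par.σminSq (sampleVar y n) with ⟨h1, -⟩ | ⟨h1, -⟩ <;> rw [h1] <;> linarith
  have hn1 : (0 : ℝ) < n - 1 := by linarith
  rw [sampleVar, ← mul_div_assoc, lt_div_iff₀ hn1] at hv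
  have h3 := mul_le_mul_of_nonneg_left (sum_sub_sampleMean_sq_le y n μ) hr0
  have h4 : 0 ≤ baseSize par lam γ Δ ^ 2 := sq_nonneg _
  nlinarith

/-- The indicator of `m` being less than the adaptive sample size. -/
noncomputable def continues (par : Params) (lam γ Δ : ℝ) (y : ℕ → ℝ) (m : ℕ) : ℝ :=
  open Classical in if (m : ℕ∞) < sampleSize par lam γ Δ y then 1 else 0

lemma continues_eq_zero_or_one : continues par lam γ Δ y m = 0 ∨ continues par lam γ Δ y m = 1 := by
  unfold continues; split_ifs <;> simp

/-- Here `s` is the minimum of the sample size and `t`. Sums weighted by `continues` are sums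
stopped there, which links Wald's identities to the adaptive rule. -/
lemma exists_stopped_range (t : ℕ) : ∃ s ≤ t, (s : ℕ∞) ≤ sampleSize par lam γ Δ y ∧
    (∀ n ≤ t, sampleSize par lam γ Δ y = n → s = n) ∧
    ∀ g : ℕ → ℝ, ∑ m ∈ Finset.range t, continues par lam γ Δ y m * g m =
      ∑ m ∈ Finset.range s, g m := by
  have key : ∀ s ≤ t, (∀ m < t, (m : ℕ∞) < sampleSize par lam γ Δ y ↔ m < s) →
      ∀ g : ℕ → ℝ, ∑ m ∈ Finset.range t, continues par lam γ Δ y m * g m =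
        ∑ m ∈ Finset.range s, g m := by
    intro s hs h g
    rw [← Finset.sum_subset (Finset.range_mono hs)]
    · refine Finset.sum_congr rfl fun m hm => ?_
      have hm' := Finset.mem_range.1 hm
      simp [continues, (h m (hm'.trans_le hs)).2 hm']
    · intro m hm hms
      simp only [Finset.mem_range] at hm hms
      simp [continues, h m hm, hms]
  cases hN : sampleSize par lam γ Δ y with
  | top =>
    refine ⟨t, le_rfl, le_top, fun n _ h => absurd h (by simp), key t le_rfl fun m hm => ?_⟩
    simp [hN, hm]
  | coe n =>
    refine ⟨min n t, min_le_right _ _, by exact_mod_cast min_le_left _ _, ?_,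
      key _ (min_le_right _ _) fun m hm => ?_⟩
    · intro k hk h
      have : n = k := by exact_mod_cast h
      omega
    · rw [hN]
      norm_cast
      omega

/-- The index just before the stopped one was rejected, so `sq_le_of_notMem_acceptedSizes` applies
to it. Stepping up by one uses `(s + 1)² ≤ 2 s² + 2`. -/
lemma sq_sum_continues_le (hlam : 0 ≤ lam) (hΔ : 0 < Δ) (μ : ℝ) (t : ℕ) :
    (∑ m ∈ Finset.range t, continues par lam γ Δ y m) ^ 2 ≤
      2 * baseSize par lam γ Δ ^ 2 + 2 + 4 * samplingRate par lam γ Δ *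
        ∑ m ∈ Finset.range t, continues par lam γ Δ y m * (y m - μ) ^ 2 := by
  obtain ⟨s, -, hsN, -, hs⟩ := exists_stopped_range par (lam := lam) (γ := γ) (Δ := Δ) (y := y) t
  have h1 := hs fun _ => 1
  simp only [mul_one, Finset.sum_const, Finset.card_range, nsmul_eq_mul] at h1
  rw [h1, hs]
  have hr0 := samplingRate_nonneg par (γ := γ) (Δ := Δ) hlam
  rcases s with _ | s
  · simp; positivity
  have hlt : (s : ℕ∞) < sampleSize par lam γ Δ y := by
    refine lt_of_lt_of_le ?_ hsN
    exact_mod_cast Nat.lt_succ_self s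
  have h2 := sq_le_of_notMem_acceptedSizes par (μ := μ) hlam hΔ
    ((lt_sampleSize_iff par).1 hlt s le_rfl)
  rw [Finset.sum_range_succ]
  have h3 : 0 ≤ samplingRate par lam γ Δ * (y s - μ) ^ 2 := by positivity
  push_cast
  nlinarith [sq_nonneg ((s : ℝ) - 1)]

lemma toENNReal_eq_tsum (N : ℕ∞) :
    (N : ℝ≥0∞) = ∑' m : ℕ, open Classical in if (m : ℕ∞) < N then (1 : ℝ≥0∞) else 0 := by
  cases N with
  | top => simp
  | coe n =>
    rw [tsum_eq_sum (s := Finset.range n)]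
    · rw [Finset.sum_congr rfl fun m hm => if_pos (by exact_mod_cast Finset.mem_range.1 hm)]
      simp
    · intro m hm
      rw [if_neg]
      simpa using hm

end SampleSize

/-! ### Moments of the sample size and of the estimation error at a fixed point -/

section FixedPoint

variable {Ω : Type*} [mΩ : MeasurableSpace Ω] {ν : Measure Ω} [IsProbabilityMeasure ν]
  (par : Params) {lam γ Δ : ℝ} {y : ℕ → Ω → ℝ} {μ v : ℝ}

/-- A bound on the expected sample size. -/
noncomputable def meanSizeBound (par : Params) (lam γ Δ v : ℝ) : ℝ :=
  3 * (4 * samplingRate par lam γ Δ * v + baseSize par lam γ Δ + 1)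

lemma measurableSet_lt_sampleSize {Ω : Type*} [MeasurableSpace Ω] {Δ : Ω → ℝ}
    (hΔ : Measurable Δ) {y : ℕ → Ω → ℝ} {m : ℕ} (hy : ∀ i < m, Measurable (y i)) :
    MeasurableSet {ω | (m : ℕ∞) < sampleSize par lam γ (Δ ω) (fun i => y i ω)} := by
  simp_rw [lt_sampleSize_iff, Set.ofPred_forall]
  refine MeasurableSet.iInter fun n => MeasurableSet.iInter fun hn => ?_
  exact (measurableSet_mem_acceptedSizes par lam γ hΔ fun i hi => hy i (hi.trans_le hn)).compl

lemma measurable_continues_apply {Ω : Type*} [MeasurableSpace Ω] {y : ℕ → Ω → ℝ} {m : ℕ}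
    (hy : ∀ i < m, Measurable (y i)) :
    Measurable fun ω => continues par lam γ Δ (fun i => y i ω) m := by
  classical
  unfold continues
  exact Measurable.ite (measurableSet_lt_sampleSize par (Δ := fun _ => Δ) measurable_const hy)
    measurable_const measurable_const

lemma measurable_continues {Ω : Type*} {y : ℕ → Ω → ℝ} (m : ℕ) :
    Measurable[pastSigma y m] fun ω => continues par lam γ Δ (fun i => y i ω) m :=
  @measurable_continues_apply par lam γ Δ Ω (pastSigma y m) y m fun _ hi => measurable_pastSigma hi

/-- Self-bounding argument: the square of the stopped time `τ` is at most a constant plus `4 r`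
times the stopped sum of squares, whose mean is `v E τ` by Wald. Stopping at `t` keeps `E τ` finite,
so it can be absorbed on the left; the bound is uniform in `t`. -/
lemma integral_sum_continues_le (hlam : 0 ≤ lam) (hΔ : 0 < Δ) (hy : ∀ m, Measurable (y m))
    (hind : iIndepFun y ν) (h2 : ∀ m, MemLp (y m) 2 ν)
    (hvar : ∀ m, ∫ ω, (y m ω - μ) ^ 2 ∂ν = v) (t : ℕ) :
    ∫ ω, ∑ m ∈ Finset.range t, continues par lam γ Δ (fun i => y i ω) m ∂ν ≤
      meanSizeBound par lam γ Δ v := by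
  set I : ℕ → Ω → ℝ := fun m ω => continues par lam γ Δ (fun i => y i ω) m with hIdef
  have hI : ∀ m, Measurable[pastSigma y m] (I m) := fun m => measurable_continues par m
  have hI01 : ∀ m ω, I m ω = 0 ∨ I m ω = 1 := fun m ω => continues_eq_zero_or_one par
  set r := samplingRate par lam γ Δ with hr
  set b := baseSize par lam γ Δ with hb
  have hr0 : 0 ≤ r := samplingRate_nonneg par hlam
  have hb2 : 2 ≤ b := two_le_baseSize par hlam
  have hv0 : 0 ≤ v := by rw [← hvar 0]; exact integral_nonneg fun _ => sq_nonneg _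
  have hw := wald_sum_sq hy hind h2 hvar hI hI01 t
  set τ : Ω → ℝ := fun ω => ∑ m ∈ Finset.range t, I m ω with hτ
  have hτi : Integrable τ ν := integrable_finsetSum _ fun m _ => integrable_indicator hy hI hI01 m
  have hQi : Integrable (fun ω => ∑ m ∈ Finset.range t, I m ω * (y m ω - μ) ^ 2) ν :=
    integrable_finsetSum _ fun m _ => integrable_indicator_mul_sq hy h2 hI hI01 m
  -- Linearize the square by `2 s τ ≤ s² + τ²`. This `s` satisfies `4 r v ≤ s` and `b² + 1 ≤ s²`, so
  -- the integrated bound reads `2 s T ≤ 3 s² + s T`.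
  set s : ℝ := 4 * r * v + b + 1 with hs
  have hs0 : 0 < s := by positivity
  have hpt : ∀ ω, 2 * s * τ ω ≤ (s ^ 2 + (2 * b ^ 2 + 2)) +
      4 * r * ∑ m ∈ Finset.range t, I m ω * (y m ω - μ) ^ 2 := by
    intro ω
    have h1 := sq_sum_continues_le par (lam := lam) (γ := γ) (Δ := Δ) (y := fun i => y i ω)
      hlam hΔ μ t
    have h3 := sq_nonneg (s - τ ω)
    simp only [hτ, hIdef] at h3 ⊢
    nlinarith
  have hint := integral_mono (hτi.const_mul (2 * s))
    ((integrable_const (s ^ 2 + (2 * b ^ 2 + 2))).add (hQi.const_mul (4 * r))) hpt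
  simp only [Pi.add_apply] at hint
  rw [integral_const_mul, integral_add (integrable_const _) (hQi.const_mul _),
    integral_const_mul, hw] at hint
  simp only [integral_const, probReal_univ, smul_eq_mul, one_mul] at hint
  set T := ∫ ω, τ ω ∂ν with hT
  have hT0 : 0 ≤ T := integral_nonneg fun ω => Finset.sum_nonneg fun m _ => by
    rcases hI01 m ω with h | h <;> simp [h]
  have hbs : b ^ 2 + 1 ≤ s ^ 2 := by
    have h1 : b + 1 ≤ s := by
      have : 0 ≤ 4 * r * v := by positivity
      linarith
    nlinarith
  have h4 : 4 * r * v ≤ s := by linarith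
  have h5 : s * T ≤ s * (3 * s) := by nlinarith
  exact le_of_mul_le_mul_left h5 hs0

lemma lintegral_sampleSize_le (hlam : 0 ≤ lam) (hΔ : 0 < Δ) (hy : ∀ m, Measurable (y m))
    (hind : iIndepFun y ν) (h2 : ∀ m, MemLp (y m) 2 ν)
    (hvar : ∀ m, ∫ ω, (y m ω - μ) ^ 2 ∂ν = v) :
    ∫⁻ ω, (sampleSize par lam γ Δ (fun i => y i ω) : ℝ≥0∞) ∂ν ≤
      ENNReal.ofReal (meanSizeBound par lam γ Δ v) := by
  classical
  simp_rw [toENNReal_eq_tsum]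
  have hm : ∀ m : ℕ, Measurable fun ω => if (m : ℕ∞) <
      sampleSize par lam γ Δ (fun i => y i ω) then (1 : ℝ≥0∞) else 0 := fun m =>
    Measurable.ite (measurableSet_lt_sampleSize par measurable_const fun i _ => hy i)
      measurable_const measurable_const
  rw [lintegral_tsum fun m => (hm m).aemeasurable]
  refine ENNReal.tsum_le_of_sum_range_le fun t => ?_
  rw [← lintegral_finsetSum _ fun m _ => hm m]
  refine le_trans (le_of_eq ?_) (ENNReal.ofReal_le_ofReal
    (integral_sum_continues_le par hlam hΔ hy hind h2 hvar t))
  rw [ofReal_integral_eq_lintegral_ofReal]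
  · refine lintegral_congr fun ω => ?_
    rw [ENNReal.ofReal_sum_of_nonneg]
    · refine Finset.sum_congr rfl fun m _ => ?_
      unfold continues
      split_ifs <;> simp
    · intro m _
      unfold continues
      split_ifs <;> simp
  · exact integrable_finsetSum _ fun m _ => integrable_indicator hy
      (fun m => measurable_continues par m) (fun m ω => continues_eq_zero_or_one par) m
  · refine Filter.Eventually.of_forall fun ω => Finset.sum_nonneg fun m _ => ?_
    unfold continues
    split_ifs <;> simp

lemma measurable_sampleSize {Ω : Type*} [MeasurableSpace Ω] {Δ : Ω → ℝ} (hΔ : Measurable Δ)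
    {y : ℕ → Ω → ℝ} (hy : ∀ i, Measurable (y i)) :
    Measurable fun ω => sampleSize par lam γ (Δ ω) (fun i => y i ω) := by
  refine measurable_to_countable' fun N => ?_
  cases N with
  | top =>
    have : (fun ω => sampleSize par lam γ (Δ ω) (fun i => y i ω)) ⁻¹' {⊤} =
        ⋂ m : ℕ, {ω | (m : ℕ∞) < sampleSize par lam γ (Δ ω) (fun i => y i ω)} := by
      ext ω
      simp [ENat.eq_top_iff_forall_gt]
    rw [this]
    exact MeasurableSet.iInter fun m => measurableSet_lt_sampleSize par hΔ fun i _ => hy i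
  | coe n =>
    have : (fun ω => sampleSize par lam γ (Δ ω) (fun i => y i ω)) ⁻¹' {(n : ℕ∞)} =
        {ω | (n : ℕ∞) < sampleSize par lam γ (Δ ω) (fun i => y i ω)}ᶜ ∩
        {ω | ∀ m < n, (m : ℕ∞) < sampleSize par lam γ (Δ ω) (fun i => y i ω)} := by
      ext ω
      simp only [Set.mem_preimage, Set.mem_singleton_iff, Set.mem_inter_iff, Set.mem_compl_iff,
        Set.mem_ofPred_eq, not_lt]
      constructor
      · intro h
        rw [h]
        exact ⟨le_rfl, fun m hm => by exact_mod_cast hm⟩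
      · rintro ⟨h1, h3⟩
        refine le_antisymm h1 (not_lt.1 fun hlt => ?_)
        obtain ⟨k, hk⟩ := ENat.ne_top_iff_exists.1 (ne_top_of_lt hlt)
        rw [← hk] at hlt
        have := h3 k (by exact_mod_cast hlt)
        rw [← hk] at this
        exact lt_irrefl _ this
    rw [this]
    refine (measurableSet_lt_sampleSize par hΔ fun i _ => hy i).compl.inter ?_
    simp_rw [Set.ofPred_forall]
    exact MeasurableSet.iInter fun m => MeasurableSet.iInter fun _ =>
      measurableSet_lt_sampleSize par hΔ fun i _ => hy i

lemma measurable_sampleMean_sampleSize {Ω : Type*} [MeasurableSpace Ω] {Δ : Ω → ℝ}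
    (hΔ : Measurable Δ) {y : ℕ → Ω → ℝ} (hy : ∀ i, Measurable (y i)) :
    Measurable fun ω => sampleMean (fun i => y i ω)
      (sampleSize par lam γ (Δ ω) (fun i => y i ω)).toNat := by
  have h1 : Measurable fun p : Ω × ℕ => sampleMean (fun i => y i p.1) p.2 :=
    measurable_from_prod_countable_left fun n => measurable_sampleMean_apply fun i _ => hy i
  exact h1.comp (measurable_id.prodMk
    ((Measurable.of_discrete (f := ENat.toNat)).comp (measurable_sampleSize par hΔ hy)))

/-- Chebyshev's inequality for the sample mean at the adaptive sample size. -/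
lemma measure_error_le (hlam : 0 < lam) (hΔ : 0 < Δ) (hy : ∀ m, Measurable (y m))
    (hind : iIndepFun y ν) (h2 : ∀ m, MemLp (y m) 2 ν) (hmean : ∀ m, ∫ ω, y m ω ∂ν = μ)
    (hvar : ∀ m, ∫ ω, (y m ω - μ) ^ 2 ∂ν = v) {e : ℝ} (he : 0 < e) :
    ν {ω | e < |sampleMean (fun i => y i ω)
        (sampleSize par lam γ Δ (fun i => y i ω)).toNat - μ|} ≤
      ENNReal.ofReal (v * meanSizeBound par lam γ Δ v /
        (samplingRate par lam γ Δ * par.σminSq * e) ^ 2) := by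
  set N : Ω → ℕ∞ := fun ω => sampleSize par lam γ Δ (fun i => y i ω) with hN
  set r := samplingRate par lam γ Δ with hr
  have hr0 : 0 < r := by
    have : 0 < par.κas * Δ ^ γ := mul_pos par.κas_pos (Real.rpow_pos_of_pos hΔ _)
    rw [hr, samplingRate]; positivity
  set a : ℝ := r * par.σminSq * e with ha
  have ha0 : 0 < a := mul_pos (mul_pos hr0 par.σminSq_pos) he
  have hv0 : 0 ≤ v := by rw [← hvar 0]; exact integral_nonneg fun _ => sq_nonneg _
  have hNm : Measurable N := measurable_sampleSize par measurable_const hy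
  -- Finite mean excludes `N = ⊤` almost surely, where `toNat` would return the default value 0.
  have hNfin : ∀ᵐ ω ∂ν, N ω ≠ ⊤ := by
    have h1 := ae_lt_top ((Measurable.of_discrete (f := ENat.toENNReal)).comp hNm)
      (ne_top_of_le_ne_top ENNReal.ofReal_ne_top
        (lintegral_sampleSize_le par hlam.le hΔ hy hind h2 hvar))
    filter_upwards [h1] with ω hω h
    simp [h] at hω
  set I : ℕ → Ω → ℝ := fun m ω => continues par lam γ Δ (fun i => y i ω) m with hIdef
  have hI : ∀ m, Measurable[pastSigma y m] (I m) := fun m => measurable_continues par m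
  have hI01 : ∀ m ω, I m ω = 0 ∨ I m ω = 1 := fun m ω => continues_eq_zero_or_one par
  set X : ℕ → Ω → ℝ := fun t ω => ∑ m ∈ Finset.range t, I m ω * (y m ω - μ) with hX
  have hX2 : ∀ t, MemLp (X t) 2 ν := fun t =>
    memLp_finsetSum _ fun m _ => memLp_indicator_mul hy h2 hI hI01 m
  have hXt : ∀ t, ν {ω | a ^ 2 ≤ X t ω ^ 2} ≤
      ENNReal.ofReal (v * meanSizeBound par lam γ Δ v / a ^ 2) := by
    intro t
    have h1 := mul_meas_ge_le_integral_of_nonneg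
      (Filter.Eventually.of_forall fun ω => sq_nonneg (X t ω)) (hX2 t).integrable_sq (a ^ 2)
    rw [wald_sq_sum hy hind h2 hmean hvar hI hI01 t] at h1
    have h3 := mul_le_mul_of_nonneg_left
      (integral_sum_continues_le par (lam := lam) (γ := γ) hlam.le hΔ hy hind h2 hvar t) hv0
    rw [← ofReal_measureReal]
    refine ENNReal.ofReal_le_ofReal ?_
    rw [le_div_iff₀ (by positivity), mul_comm]
    exact h1.trans h3
  set A : ℕ → Set Ω := fun t => {ω | N ω ≤ t ∧
    e < |sampleMean (fun i => y i ω) (N ω).toNat - μ|} with hA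
  have hAmono : Monotone A := fun s t hst ω hω =>
    ⟨hω.1.trans (by exact_mod_cast hst), hω.2⟩
  -- Once `N ≤ t`, the stopped sum is `N` times the estimation error, and `N ≥ r σminSq`. An error
  -- above `e` therefore pushes it beyond `a`.
  have hsub : ∀ t, A t ⊆ {ω | a ^ 2 ≤ X t ω ^ 2} := by
    rintro t ω ⟨h1, h3⟩
    obtain ⟨n, hn⟩ := ENat.ne_top_iff_exists.1 (ne_top_of_le_ne_top (ENat.natCast_ne_top t) h1)
    have hnt : n ≤ t := by rw [← hn] at h1; exact_mod_cast h1
    obtain ⟨s, -, -, hs, hsum⟩ := exists_stopped_range par (lam := lam) (γ := γ) (Δ := Δ)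
      (y := fun i => y i ω) t
    obtain rfl := hs n hnt hn.symm
    have hacc := mem_acceptedSizes_of_sampleSize_eq par
      (show sampleSize par lam γ Δ (fun i => y i ω) = s from hn.symm)
    have hspos : (0 : ℝ) < s := by exact_mod_cast pos_of_mem_acceptedSizes par hacc
    have hle := le_of_mem_acceptedSizes par hlam.le hΔ hacc
    have hXs : X t ω = s * (sampleMean (fun i => y i ω) s - μ) := by
      simp only [hX, hIdef]
      rw [hsum fun m => y m ω - μ, Finset.sum_sub_distrib, sampleMean]
      simp
      field_simp
    rw [← hn, ENat.toNat_natCast] at h3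
    simp only [Set.mem_ofPred_eq]
    rw [sq_le_sq, abs_of_pos ha0, hXs, abs_mul, abs_of_pos hspos]
    exact mul_le_mul hle h3.le he.le hspos.le
  have hunion : {ω | e < |sampleMean (fun i => y i ω) (N ω).toNat - μ|} ≤ᵐ[ν] ⋃ t, A t := by
    filter_upwards [hNfin] with ω hω h
    obtain ⟨n, hn⟩ := ENat.ne_top_iff_exists.1 hω
    exact Set.mem_iUnion.2 ⟨n, hn.symm.le, h⟩
  refine (measure_mono_ae hunion).trans ?_
  rw [hAmono.measure_iUnion]
  exact iSup_le fun t => (measure_mono (hsub t)).trans (hXt t)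

end FixedPoint

/-! ### Measurability of a run -/

section Measurability

variable {Ω : Type*} {d q : ℕ} {P : Problem d q} {par : Params} {lam : ℕ → ℝ} {γ : ℝ}
  {θ₀ : EuclideanSpace ℝ (Fin d)} {U : ℕ → Option (Node d) → ℕ → Ω → (Fin q → ℝ)}
  {R : Trajectory Ω d}

lemma IsRun.radius_pos (hR : IsRun P par lam γ θ₀ U R) (k : ℕ) (ω : Ω) : 0 < R.Δ k ω := by
  induction k with
  | zero => rw [hR.init_Δ]; exact par.Δ₀_pos
  | succ k ih =>
    by_cases h : R.Success P par lam γ U k ω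
    · rw [(hR.step_success k ω h).2]
      exact lt_min (mul_pos (zero_lt_one.trans par.one_lt_γup) ih) par.Δmax_pos
    · rw [(hR.step_failure k ω h).2]
      exact mul_pos par.γlow_pos ih

lemma IsRun.radius_le (hR : IsRun P par lam γ θ₀ U R) (k : ℕ) (ω : Ω) :
    R.Δ k ω ≤ max par.Δ₀ par.Δmax := by
  induction k with
  | zero => rw [hR.init_Δ]; exact le_max_left _ _
  | succ k ih =>
    by_cases h : R.Success P par lam γ U k ω
    · rw [(hR.step_success k ω h).2]
      exact (min_le_right _ _).trans (le_max_right _ _)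
    · rw [(hR.step_failure k ω h).2]
      refine le_trans ?_ ih
      exact mul_le_of_le_one_left (hR.radius_pos k ω).le par.γlow_lt_one.le

lemma measurable_oracle
    (hF : Measurable fun z : EuclideanSpace ℝ (Fin d) × (Fin q → ℝ) => P.F z.1 z.2)
    (hmap : Measurable fun z : EuclideanSpace ℝ (Fin d) × (Fin q → ℝ) => P.invMap z.1 z.2) :
    Measurable fun z : EuclideanSpace ℝ (Fin d) × (Fin q → ℝ) => P.oracle z.1 z.2 :=
  hF.comp (measurable_fst.prodMk hmap)

lemma measurable_coord (j : Fin d) : Measurable fun x : EuclideanSpace ℝ (Fin d) => x j :=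
  (EuclideanSpace.proj (𝕜 := ℝ) j).continuous.measurable

variable [MeasurableSpace Ω]

lemma measurable_node {c : Ω → EuclideanSpace ℝ (Fin d)} {Δ : Ω → ℝ} (hc : Measurable c)
    (hΔ : Measurable Δ) (i : Node d) : Measurable fun ω => node (c ω) (Δ ω) i := by
  rcases i with _ | j | j
  · exact hc
  · exact hc.add (hΔ.smul_const _)
  · exact hc.sub (hΔ.smul_const _)

lemma measurable_model {c x : Ω → EuclideanSpace ℝ (Fin d)} {β : Ω → Node d → ℝ}
    (hc : Measurable c) (hx : Measurable x) (hβ : ∀ j, Measurable fun ω => β ω j) :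
    Measurable fun ω => model (c ω) (β ω) (x ω) := by
  refine Finset.measurable_fun_sum _ fun i _ => (hβ i).mul ?_
  have h : ∀ j, Measurable fun ω => x ω j - c ω j := fun j =>
    ((measurable_coord j).comp hx).sub ((measurable_coord j).comp hc)
  rcases i with _ | j | j
  · exact measurable_const
  · exact h j
  · exact ((h j).pow_const 2).div_const 2

lemma measurable_norm_modelGrad {β : Ω → Node d → ℝ} (hβ : ∀ j, Measurable fun ω => β ω j) :
    Measurable fun ω => ‖modelGrad (β ω)‖ := by
  simp_rw [EuclideanSpace.norm_eq, modelGrad_apply]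
  exact (Finset.measurable_fun_sum _ fun j _ => ((hβ _).norm.pow_const 2)).sqrt

lemma measurable_point {k : ℕ} (hθ : Measurable (R.θ k)) (hΔ : Measurable (R.Δ k))
    (hcand : Measurable (R.cand k)) (a : Option (Node d)) :
    Measurable fun ω => R.point k ω a := by
  rcases a with _ | i
  · exact hcand
  · exact measurable_node hθ hΔ i

lemma measurable_estimate (ho : Measurable fun z : EuclideanSpace ℝ (Fin d) × (Fin q → ℝ) =>
      P.oracle z.1 z.2) {k : ℕ} {a : Option (Node d)} (hp : Measurable fun ω => R.point k ω a)
    (hΔ : Measurable (R.Δ k)) (hU : ∀ i, Measurable (U k a i)) :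
    Measurable fun ω => R.estimate P par lam γ U k a ω :=
  measurable_sampleMean_sampleSize par (y := fun i ω => P.oracle (R.point k ω a) (U k a i ω)) hΔ
    fun i => ho.comp (hp.prodMk (hU i))

lemma IsRun.measurable_coeff (hR : IsRun P par lam γ θ₀ U R) {k : ℕ} (hΔ : Measurable (R.Δ k))
    (he : ∀ i, Measurable fun ω => R.estimate P par lam γ U k (some i) ω) (i : Node d) :
    Measurable fun ω => R.β k ω i := by
  rcases i with _ | j | j
  · simp_rw [fun ω => coeff_none (hR.interpolates k ω)]
    exact he none
  · simp_rw [fun ω => coeff_inl (hR.radius_pos k ω) (hR.interpolates k ω) j]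
    exact ((he _).sub (he _)).div (hΔ.const_mul 2)
  · simp_rw [fun ω => coeff_inr (hR.radius_pos k ω) (hR.interpolates k ω) j]
    exact (((he _).add (he _)).sub ((he _).const_mul 2)).div (hΔ.pow_const 2)

/-- The σ-algebra on `Ω` is arbitrary here. Instantiated with a `streamSigma`, the statement becomes
adaptedness of the run. -/
lemma IsRun.measurable_step (hR : IsRun P par lam γ θ₀ U R)
    (ho : Measurable fun z : EuclideanSpace ℝ (Fin d) × (Fin q → ℝ) => P.oracle z.1 z.2) {k : ℕ}
    (hθ : Measurable (R.θ k)) (hΔ : Measurable (R.Δ k)) (hcand : Measurable (R.cand k))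
    (hU : ∀ a i, Measurable (U k a i)) :
    Measurable (R.θ (k + 1)) ∧ Measurable (R.Δ (k + 1)) := by
  classical
  have he : ∀ a, Measurable fun ω => R.estimate P par lam γ U k a ω := fun a =>
    measurable_estimate ho (measurable_point hθ hΔ hcand a) hΔ (hU a)
  have hβ := hR.measurable_coeff hΔ fun i => he (some i)
  have hratio : Measurable fun ω => R.ratio P par lam γ U k ω :=
    ((he _).sub (he _)).div ((measurable_model hθ hθ hβ).sub (measurable_model hθ hcand hβ))
  have hsucc : MeasurableSet {ω | R.Success P par lam γ U k ω} := by
    unfold Trajectory.Success Trajectory.surrogate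
    simp_rw [gradient_model]
    exact (measurableSet_le measurable_const hratio).inter
      (measurableSet_le hΔ ((measurable_norm_modelGrad hβ).const_mul _))
  have h1 : R.θ (k + 1) = fun ω => if R.Success P par lam γ U k ω then R.cand k ω else R.θ k ω := by
    ext1 ω
    split_ifs with h
    · exact (hR.step_success k ω h).1
    · exact (hR.step_failure k ω h).1
  have h2 : R.Δ (k + 1) = fun ω => if R.Success P par lam γ U k ω then
      min (par.γup * R.Δ k ω) par.Δmax else par.γlow * R.Δ k ω := by
    ext1 ω
    split_ifs with h
    · exact (hR.step_success k ω h).2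
    · exact (hR.step_failure k ω h).2
  rw [h1, h2]
  exact ⟨Measurable.ite hsucc hcand hθ,
    Measurable.ite hsucc ((hΔ.const_mul _).min measurable_const) (hΔ.const_mul _)⟩

end Measurability

/-! ### Information and independence -/

section Information

variable {Ω : Type*} {d q : ℕ} {P : Problem d q} {par : Params} {lam : ℕ → ℝ} {γ : ℝ}
  {θ₀ : EuclideanSpace ℝ (Fin d)} {U : ℕ → Option (Node d) → ℕ → Ω → (Fin q → ℝ)}
  {R : Trajectory Ω d}

/-- The σ-algebra generated by the uniform vectors with indices in `S`. -/
@[reducible]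
def streamSigma (U : ℕ → Option (Node d) → ℕ → Ω → (Fin q → ℝ))
    (S : Set (ℕ × Option (Node d) × ℕ)) : MeasurableSpace Ω :=
  ⨆ t ∈ S, MeasurableSpace.comap (U t.1 t.2.1 t.2.2) inferInstance

lemma measurable_streamSigma {S : Set (ℕ × Option (Node d) × ℕ)} {k : ℕ} {a : Option (Node d)}
    {i : ℕ} (h : (k, a, i) ∈ S) : Measurable[streamSigma U S] (U k a i) :=
  measurable_iff_comap_le.2 (le_iSup₂_of_le
    (f := fun (t : ℕ × Option (Node d) × ℕ) (_ : t ∈ S) =>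
      MeasurableSpace.comap (U t.1 t.2.1 t.2.2) inferInstance) (k, a, i) h le_rfl)

lemma streamSigma_mono {S T : Set (ℕ × Option (Node d) × ℕ)} (h : S ⊆ T) :
    streamSigma U S ≤ streamSigma U T :=
  iSup₂_le fun _ ht => measurable_iff_comap_le.1 (measurable_streamSigma (h ht))

/-- Indices of the vectors drawn before iteration `k`. -/
def pastIndices (d k : ℕ) : Set (ℕ × Option (Node d) × ℕ) := {t | t.1 < k}

/-- Indices of the vectors that determine the point `a` of iteration `k`. -/
def priorIndices (k : ℕ) (a : Option (Node d)) : Set (ℕ × Option (Node d) × ℕ) :=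
  {t | t.1 < k ∨ t.1 = k ∧ t.2.1 ≠ none ∧ a = none}

lemma pastIndices_subset (k : ℕ) (a : Option (Node d)) : pastIndices d k ⊆ priorIndices k a :=
  fun _ h => Or.inl h

lemma pastIndices_mono : Monotone (pastIndices d) :=
  fun _ _ hkl _ h => lt_of_lt_of_le h hkl

lemma history_le (k : ℕ) : history U k ≤ streamSigma U (priorIndices k none) := by
  refine iSup_le fun j => iSup_le fun a => iSup_le fun m => iSup_le fun h => ?_
  refine measurable_iff_comap_le.1 (measurable_streamSigma ?_)
  rcases h with h | ⟨h1, h2⟩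
  · exact Or.inl h
  · exact Or.inr ⟨h1, h2, rfl⟩

lemma priorIndices_subset (k : ℕ) (a : Option (Node d)) :
    priorIndices k a ⊆ pastIndices d (k + 1) := by
  rintro t (h | ⟨h, -⟩)
  · exact Nat.lt_succ_of_lt h
  · exact Nat.lt_succ_of_le h.le

lemma IsRun.measurable_state (hR : IsRun P par lam γ θ₀ U R)
    (ho : Measurable fun z : EuclideanSpace ℝ (Fin d) × (Fin q → ℝ) => P.oracle z.1 z.2) (k : ℕ) :
    Measurable[streamSigma U (pastIndices d k)] (R.θ k) ∧
      Measurable[streamSigma U (pastIndices d k)] (R.Δ k) := by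
  induction k with
  | zero =>
    rw [show R.θ 0 = fun _ => θ₀ from funext hR.init_θ,
      show R.Δ 0 = fun _ => par.Δ₀ from funext hR.init_Δ]
    exact ⟨measurable_const, measurable_const⟩
  | succ k ih =>
    have hmono : streamSigma U (pastIndices d k) ≤ streamSigma U (pastIndices d (k + 1)) :=
      streamSigma_mono (pastIndices_mono (Nat.le_succ k))
    exact @IsRun.measurable_step Ω d q P par lam γ θ₀ U R (streamSigma U (pastIndices d (k + 1)))
      hR ho k (ih.1.mono hmono le_rfl) (ih.2.mono hmono le_rfl)
      ((hR.cand_adapted k).mono ((history_le k).trans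
        (streamSigma_mono (priorIndices_subset k none))) le_rfl)
      fun a i => measurable_streamSigma (Nat.lt_succ_self k)

lemma IsRun.measurable_point_prior (hR : IsRun P par lam γ θ₀ U R)
    (ho : Measurable fun z : EuclideanSpace ℝ (Fin d) × (Fin q → ℝ) => P.oracle z.1 z.2) (k : ℕ)
    (a : Option (Node d)) :
    Measurable[streamSigma U (priorIndices k a)] fun ω => R.point k ω a := by
  have hmono := streamSigma_mono (U := U) (pastIndices_subset k a)
  obtain ⟨h1, h2⟩ := hR.measurable_state ho k
  rcases a with _ | i
  · exact (hR.cand_adapted k).mono (history_le k) le_rfl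
  · exact (@measurable_node Ω d (streamSigma U (pastIndices d k)) _ _ h1 h2 i).mono hmono le_rfl

lemma IsRun.measurable_radius_prior (hR : IsRun P par lam γ θ₀ U R)
    (ho : Measurable fun z : EuclideanSpace ℝ (Fin d) × (Fin q → ℝ) => P.oracle z.1 z.2) (k : ℕ)
    (a : Option (Node d)) : Measurable[streamSigma U (priorIndices k a)] (R.Δ k) :=
  (hR.measurable_state ho k).2.mono (streamSigma_mono (pastIndices_subset k a)) le_rfl

variable [mΩ : MeasurableSpace Ω] {ν : Measure Ω}

lemma IsUniformSampling.streamSigma_le (hU : IsUniformSampling ν U)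
    (S : Set (ℕ × Option (Node d) × ℕ)) : streamSigma U S ≤ mΩ :=
  iSup₂_le fun _ _ => (hU.measurable _ _ _).comap_le

/-- What is known before the point `a` of iteration `k` is evaluated is independent of the stream
that is used there. -/
lemma IsUniformSampling.indepFun_stream {E : Type*} [MeasurableSpace E]
    (hU : IsUniformSampling ν U) (k : ℕ) (a : Option (Node d)) {Z : Ω → E}
    (hZ : Measurable[streamSigma U (priorIndices k a)] Z) :
    IndepFun Z (fun ω i => U k a i ω) ν := by
  have h := indep_iSup_of_disjoint
    (fun t : ℕ × Option (Node d) × ℕ => (hU.measurable t.1 t.2.1 t.2.2).comap_le) hU.indep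
    (S := priorIndices k a) (T := {t | t.1 = k ∧ t.2.1 = a}) (by
      rw [Set.disjoint_left]
      rintro ⟨j, b, i⟩ (h | ⟨-, h2, h3⟩) ⟨h4, h5⟩
      · exact absurd h4 (ne_of_lt h)
      · exact h2 (h5.trans h3))
  refine indep_of_indep_of_le_left (indep_of_indep_of_le_right h ?_)
    (measurable_iff_comap_le.1 hZ)
  refine measurable_iff_comap_le.1 (@measurable_pi_lambda _ _ _ (streamSigma U _) _ _ fun i => ?_)
  exact measurable_streamSigma ⟨rfl, rfl⟩

/-- Integration of a function of two independent variables. -/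
lemma lintegral_of_indepFun [IsProbabilityMeasure ν] {E G : Type*} [MeasurableSpace E]
    [MeasurableSpace G] {Z : Ω → E} {u : Ω → G} (hZ : Measurable Z) (hu : Measurable u)
    (h : IndepFun Z u ν) {Φ : E → G → ℝ≥0∞} (hΦ : Measurable fun z : E × G => Φ z.1 z.2) :
    ∫⁻ ω, Φ (Z ω) (u ω) ∂ν = ∫⁻ ω, ∫⁻ ω', Φ (Z ω) (u ω') ∂ν ∂ν := by
  have hmap := (indepFun_iff_map_prod_eq_prod_map_map hZ.aemeasurable hu.aemeasurable).1 h
  have : IsProbabilityMeasure (ν.map u) := Measure.isProbabilityMeasure_map hu.aemeasurable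
  calc ∫⁻ ω, Φ (Z ω) (u ω) ∂ν = ∫⁻ z, Φ z.1 z.2 ∂(ν.map fun ω => (Z ω, u ω)) :=
        (lintegral_map hΦ (hZ.prodMk hu)).symm
    _ = ∫⁻ x, ∫⁻ y, Φ x y ∂(ν.map u) ∂(ν.map Z) := by
        rw [hmap, lintegral_prod _ hΦ.aemeasurable]
    _ = ∫⁻ ω, ∫⁻ y, Φ (Z ω) y ∂(ν.map u) ∂ν := by
        rw [lintegral_map hΦ.lintegral_prod_right' hZ]
    _ = _ := by
        refine lintegral_congr fun ω => ?_
        exact lintegral_map (f := Φ (Z ω)) (hΦ.comp measurable_prodMk_left) hu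

end Information

/-! ### The oracle at a fixed point -/

section Oracle

variable {Ω : Type*} [mΩ : MeasurableSpace Ω] {ν : Measure Ω} {d q : ℕ} {P : Problem d q}
  {U : ℕ → Option (Node d) → ℕ → Ω → (Fin q → ℝ)}

lemma measurable_oracle_stream
    (hF : Measurable fun z : EuclideanSpace ℝ (Fin d) × (Fin q → ℝ) => P.F z.1 z.2)
    (hmap : Measurable fun z : EuclideanSpace ℝ (Fin d) × (Fin q → ℝ) => P.invMap z.1 z.2)
    (hU : IsUniformSampling ν U) (θ : EuclideanSpace ℝ (Fin d)) (k : ℕ) (a : Option (Node d))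
    (i : ℕ) : Measurable fun ω => P.oracle θ (U k a i ω) :=
  (measurable_oracle hF hmap).comp (measurable_const.prodMk (hU.measurable k a i))

lemma iIndepFun_oracle_stream
    (hF : Measurable fun z : EuclideanSpace ℝ (Fin d) × (Fin q → ℝ) => P.F z.1 z.2)
    (hmap : Measurable fun z : EuclideanSpace ℝ (Fin d) × (Fin q → ℝ) => P.invMap z.1 z.2)
    (hU : IsUniformSampling ν U) (θ : EuclideanSpace ℝ (Fin d)) (k : ℕ) (a : Option (Node d)) :
    iIndepFun (fun i ω => P.oracle θ (U k a i ω)) ν := by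
  have h := hU.indep.precomp (g := fun i : ℕ => ((k, a, i) : ℕ × Option (Node d) × ℕ))
    fun i j hij => by simpa using hij
  exact h.comp (fun _ u => P.oracle θ u) fun _ =>
    (measurable_oracle hF hmap).comp (measurable_const.prodMk measurable_id)

lemma map_invMap_stream
    (hmap : Measurable fun z : EuclideanSpace ℝ (Fin d) × (Fin q → ℝ) => P.invMap z.1 z.2)
    (hU : IsUniformSampling ν U) (θ : EuclideanSpace ℝ (Fin d)) (k : ℕ) (a : Option (Node d)) (i : ℕ) :
    ν.map (P.invMap θ ∘ U k a i) = P.law θ := by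
  have h1 : Measurable (P.invMap θ) := hmap.comp (measurable_const.prodMk measurable_id)
  rw [Problem.law, ← hU.uniform k a i, Measure.map_map h1 (hU.measurable k a i)]

lemma memLp_oracle_stream
    (hmap : Measurable fun z : EuclideanSpace ℝ (Fin d) × (Fin q → ℝ) => P.invMap z.1 z.2)
    (hU : IsUniformSampling ν U) {θ : EuclideanSpace ℝ (Fin d)} (hL2 : MemLp (P.F θ) 2 (P.law θ)) (k : ℕ)
    (a : Option (Node d)) (i : ℕ) : MemLp (fun ω => P.oracle θ (U k a i ω)) 2 ν := by
  have h1 : Measurable (P.invMap θ) := hmap.comp (measurable_const.prodMk measurable_id)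
  rw [← map_invMap_stream hmap hU θ k a i] at hL2
  exact hL2.comp_of_map (h1.comp (hU.measurable k a i)).aemeasurable

lemma integral_oracle_stream
    (hF : Measurable fun z : EuclideanSpace ℝ (Fin d) × (Fin q → ℝ) => P.F z.1 z.2)
    (hmap : Measurable fun z : EuclideanSpace ℝ (Fin d) × (Fin q → ℝ) => P.invMap z.1 z.2)
    (hU : IsUniformSampling ν U) (θ : EuclideanSpace ℝ (Fin d)) (k : ℕ) (a : Option (Node d)) (i : ℕ) :
    ∫ ω, P.oracle θ (U k a i ω) ∂ν = P.objective θ := by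
  have h1 : Measurable (P.invMap θ) := hmap.comp (measurable_const.prodMk measurable_id)
  have h2 : Measurable (P.F θ) := hF.comp (measurable_const.prodMk measurable_id)
  rw [Problem.objective, ← map_invMap_stream hmap hU θ k a i,
    integral_map (h1.comp (hU.measurable k a i)).aemeasurable h2.aestronglyMeasurable]
  rfl

lemma integral_sq_oracle_stream
    (hF : Measurable fun z : EuclideanSpace ℝ (Fin d) × (Fin q → ℝ) => P.F z.1 z.2)
    (hmap : Measurable fun z : EuclideanSpace ℝ (Fin d) × (Fin q → ℝ) => P.invMap z.1 z.2)
    (hU : IsUniformSampling ν U) (θ : EuclideanSpace ℝ (Fin d)) (k : ℕ) (a : Option (Node d))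
    (i : ℕ) : ∫ ω, (P.oracle θ (U k a i ω) - P.objective θ) ^ 2 ∂ν = Var[P.F θ; P.law θ] := by
  have h1 : Measurable (P.invMap θ) := hmap.comp (measurable_const.prodMk measurable_id)
  have h2 : Measurable (P.F θ) := hF.comp (measurable_const.prodMk measurable_id)
  rw [variance_eq_integral h2.aemeasurable]
  nth_rewrite 1 [← map_invMap_stream hmap hU θ k a i]
  rw [integral_map (h1.comp (hU.measurable k a i)).aemeasurable
    ((h2.sub_const _).pow_const 2).aestronglyMeasurable]
  rfl

end Oracle

/-! ### Sample sizes and errors along a run -/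

section AlongRun

variable {Ω : Type*} [mΩ : MeasurableSpace Ω] {ν : Measure Ω} [IsProbabilityMeasure ν] {d q : ℕ}
  {P : Problem d q} {par : Params} {lam : ℕ → ℝ} {γ V : ℝ} {θ₀ : EuclideanSpace ℝ (Fin d)}
  {U : ℕ → Option (Node d) → ℕ → Ω → (Fin q → ℝ)} {R : Trajectory Ω d}

lemma meanSizeBound_mono {l g D v w : ℝ} (hl : 0 ≤ l) (hvw : v ≤ w) :
    meanSizeBound par l g D v ≤ meanSizeBound par l g D w := by
  have := samplingRate_nonneg par (γ := g) (Δ := D) hl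
  unfold meanSizeBound
  gcongr

lemma meanSizeBound_nonneg {l g D v : ℝ} (hl : 0 ≤ l) (hv : 0 ≤ v) :
    0 ≤ meanSizeBound par l g D v := by
  have := samplingRate_nonneg par (γ := g) (Δ := D) hl
  have := two_le_baseSize par (γ := g) (Δ := D) hl
  unfold meanSizeBound
  positivity

/-- The expected sample size, weighted by a quantity known before the evaluation. -/
lemma lintegral_mul_size_le
    (hF : Measurable fun z : EuclideanSpace ℝ (Fin d) × (Fin q → ℝ) => P.F z.1 z.2)
    (hmap : Measurable fun z : EuclideanSpace ℝ (Fin d) × (Fin q → ℝ) => P.invMap z.1 z.2)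
    (hL2 : ∀ θ, MemLp (P.F θ) 2 (P.law θ)) (hV : ∀ θ, Var[P.F θ; P.law θ] ≤ V)
    (hU : IsUniformSampling ν U) (hR : IsRun P par lam γ θ₀ U R) {k : ℕ} (hlam : 0 ≤ lam k)
    (a : Option (Node d)) {w : Ω → ℝ≥0∞} (hw : Measurable[streamSigma U (priorIndices k a)] w) :
    ∫⁻ ω, w ω * (R.size P par lam γ U k a ω : ℝ≥0∞) ∂ν ≤
      ∫⁻ ω, w ω * ENNReal.ofReal (meanSizeBound par (lam k) γ (R.Δ k ω) V) ∂ν := by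
  have ho := measurable_oracle hF hmap
  -- `Z` collects all that is known before the evaluation and enters the integrand. It is
  -- independent of the stream, so it can be frozen and the fixed-point bound applied.
  set Z : Ω → EuclideanSpace ℝ (Fin d) × ℝ × ℝ≥0∞ :=
    fun ω => (R.point k ω a, R.Δ k ω, w ω) with hZdef
  have hZ : Measurable[streamSigma U (priorIndices k a)] Z :=
    (hR.measurable_point_prior ho k a).prodMk ((hR.measurable_radius_prior ho k a).prodMk hw)
  have hu : Measurable fun ω i => U k a i ω := measurable_pi_lambda _ fun i => hU.measurable k a i
  set Φ : EuclideanSpace ℝ (Fin d) × ℝ × ℝ≥0∞ → (ℕ → Fin q → ℝ) → ℝ≥0∞ := fun z u =>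
    z.2.2 * (sampleSize par (lam k) γ z.2.1 (fun i => P.oracle z.1 (u i)) : ℝ≥0∞) with hΦdef
  have hΦ : Measurable fun z : (EuclideanSpace ℝ (Fin d) × ℝ × ℝ≥0∞) × (ℕ → Fin q → ℝ) =>
      Φ z.1 z.2 := by
    refine measurable_fst.snd.snd.mul ((Measurable.of_discrete (f := ENat.toENNReal)).comp ?_)
    exact measurable_sampleSize par (Δ := fun z : (EuclideanSpace ℝ (Fin d) × ℝ × ℝ≥0∞) ×
      (ℕ → Fin q → ℝ) => z.1.2.1) measurable_fst.snd.fst (y := fun i z => P.oracle z.1.1 (z.2 i))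
      fun i => ho.comp (measurable_fst.fst.prodMk ((measurable_pi_apply i).comp measurable_snd))
  change ∫⁻ ω, Φ (Z ω) (fun i => U k a i ω) ∂ν ≤ _
  rw [lintegral_of_indepFun (hZ.mono (hU.streamSigma_le _) le_rfl) hu
    (hU.indepFun_stream k a hZ) hΦ]
  refine lintegral_mono fun ω => ?_
  simp only [hΦdef, hZdef]
  have hN : Measurable fun ω' => (sampleSize par (lam k) γ (R.Δ k ω)
      (fun i => P.oracle (R.point k ω a) (U k a i ω')) : ℝ≥0∞) :=
    (Measurable.of_discrete (f := ENat.toENNReal)).comp (measurable_sampleSize par measurable_const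
      fun i => measurable_oracle_stream hF hmap hU _ k a i)
  rw [lintegral_const_mul _ hN]
  gcongr
  refine (lintegral_sampleSize_le par hlam (hR.radius_pos k ω)
    (fun i => measurable_oracle_stream hF hmap hU _ k a i) (iIndepFun_oracle_stream hF hmap hU _ k a)
    (fun i => memLp_oracle_stream hmap hU (hL2 _) k a i)
    fun i => integral_sq_oracle_stream hF hmap hU _ k a i).trans ?_
  exact ENNReal.ofReal_le_ofReal (meanSizeBound_mono hlam (hV _))

/-- Since `r κas² D⁴ = l`, the mean size is `O(r)`: `l ≥ 1` absorbs the constants into `l`, and `D ≤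
M` bounds `l` by a multiple of `r`. Dividing by `(r D²)²` leaves `1 / (r D⁴)`, of order `1 / l`;
this cancellation uses the exponent 2. -/
lemma error_bound_le {l D M e v : ℝ} (hl : 1 ≤ l) (hD : 0 < D) (hDM : D ≤ M) (he : 0 < e)
    (hv : 0 ≤ v) (hvV : v ≤ V) :
    v * meanSizeBound par l 2 D v / (samplingRate par l 2 D * par.σminSq * (e * D ^ 2)) ^ 2 ≤
      V * (3 * (4 * V + par.σminSq + (par.n₀ + 4) * par.κas ^ 2 * M ^ 4)) * par.κas ^ 2 /
        (par.σminSq * e) ^ 2 / l := by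
  have hκ := par.κas_pos
  have hσ := par.σminSq_pos
  have hl0 : 0 < l := by linarith
  set r := samplingRate par l 2 D with hr
  have hrl : r * (par.κas ^ 2 * D ^ 4) = l := by
    rw [hr, samplingRate, Real.rpow_two]
    field_simp
  have hr0 : 0 < r := by rw [hr, samplingRate]; positivity
  have hm : meanSizeBound par l 2 D v ≤
      3 * (4 * V + par.σminSq + (par.n₀ + 4) * par.κas ^ 2 * M ^ 4) * r := by
    have h1 : (par.n₀ : ℝ) + l + 3 ≤ (par.n₀ + 4) * l := by
      have : (0 : ℝ) ≤ par.n₀ := Nat.cast_nonneg _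
      nlinarith
    have h2 : (par.n₀ + 4 : ℝ) * l ≤ (par.n₀ + 4) * (r * (par.κas ^ 2 * M ^ 4)) := by
      rw [← hrl]; gcongr
    have h3 : r * v ≤ r * V := by gcongr
    rw [meanSizeBound, baseSize, ← hr]
    linarith
  have hV0 : 0 ≤ V := hv.trans hvV
  calc v * meanSizeBound par l 2 D v / (r * par.σminSq * (e * D ^ 2)) ^ 2
      ≤ V * (3 * (4 * V + par.σminSq + (par.n₀ + 4) * par.κas ^ 2 * M ^ 4) * r) /
          (r * par.σminSq * (e * D ^ 2)) ^ 2 := by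
        have := meanSizeBound_nonneg (par := par) (g := 2) (D := D) hl0.le hv
        gcongr
    _ = _ := by
        rw [← hrl]
        field_simp

/-- The probability that an estimate is inaccurate. -/
lemma measure_estimate_error_le
    (hF : Measurable fun z : EuclideanSpace ℝ (Fin d) × (Fin q → ℝ) => P.F z.1 z.2)
    (hmap : Measurable fun z : EuclideanSpace ℝ (Fin d) × (Fin q → ℝ) => P.invMap z.1 z.2)
    (hL2 : ∀ θ, MemLp (P.F θ) 2 (P.law θ)) (hV : ∀ θ, Var[P.F θ; P.law θ] ≤ V)
    (hf : Measurable P.objective)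
    (hU : IsUniformSampling ν U) (hR : IsRun P par lam 2 θ₀ U R) {k : ℕ} (hlam : 1 ≤ lam k)
    (a : Option (Node d)) {e : ℝ} (he : 0 < e) :
    ν {ω | e * R.Δ k ω ^ 2 <
        |R.estimate P par lam 2 U k a ω - P.objective (R.point k ω a)|} ≤
      ENNReal.ofReal (V * (3 * (4 * V + par.σminSq +
        (par.n₀ + 4) * par.κas ^ 2 * max par.Δ₀ par.Δmax ^ 4)) * par.κas ^ 2 /
        (par.σminSq * e) ^ 2 / lam k) := by
  classical
  have ho := measurable_oracle hF hmap
  have hlam0 : 0 < lam k := by linarith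
  set Z : Ω → EuclideanSpace ℝ (Fin d) × ℝ := fun ω => (R.point k ω a, R.Δ k ω) with hZdef
  have hZ : Measurable[streamSigma U (priorIndices k a)] Z :=
    (hR.measurable_point_prior ho k a).prodMk (hR.measurable_radius_prior ho k a)
  have hZ' : Measurable Z := hZ.mono (hU.streamSigma_le _) le_rfl
  have hu : Measurable fun ω i => U k a i ω := measurable_pi_lambda _ fun i => hU.measurable k a i
  set B : Set ((EuclideanSpace ℝ (Fin d) × ℝ) × (ℕ → Fin q → ℝ)) :=
    {z | e * z.1.2 ^ 2 < |sampleMean (fun i => P.oracle z.1.1 (z.2 i))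
      (sampleSize par (lam k) 2 z.1.2 (fun i => P.oracle z.1.1 (z.2 i))).toNat -
        P.objective z.1.1|} with hB
  have hBm : MeasurableSet B := by
    have h1 := measurable_sampleMean_sampleSize par (lam := lam k) (γ := 2)
      (Δ := fun z : (EuclideanSpace ℝ (Fin d) × ℝ) × (ℕ → Fin q → ℝ) => z.1.2)
      measurable_fst.snd (y := fun i z => P.oracle z.1.1 (z.2 i))
      fun i => ho.comp (measurable_fst.fst.prodMk ((measurable_pi_apply i).comp measurable_snd))
    exact measurableSet_lt ((measurable_fst.snd.pow_const 2).const_mul e)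
      (h1.sub (hf.comp measurable_fst.fst)).abs
  have hset : MeasurableSet {ω | (Z ω, fun i => U k a i ω) ∈ B} := (hZ'.prodMk hu) hBm
  change ν {ω | (Z ω, fun i => U k a i ω) ∈ B} ≤ _
  rw [← lintegral_indicator_one hset]
  change ∫⁻ ω, B.indicator 1 (Z ω, fun i => U k a i ω) ∂ν ≤ _
  rw [lintegral_of_indepFun (Φ := fun z u => B.indicator 1 (z, u)) hZ' hu
    (hU.indepFun_stream k a hZ) (measurable_one.indicator hBm)]
  refine (lintegral_mono fun ω => ?_).trans
    (by rw [lintegral_const, measure_univ, mul_one])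
  have hslice : MeasurableSet {ω' | (Z ω, fun i => U k a i ω') ∈ B} :=
    (measurable_const.prodMk hu) hBm
  change ∫⁻ ω', {ω' | (Z ω, fun i => U k a i ω') ∈ B}.indicator 1 ω' ∂ν ≤ _
  rw [lintegral_indicator_one hslice]
  have hD := hR.radius_pos k ω
  refine (measure_error_le par (γ := 2) hlam0 hD
    (fun i => measurable_oracle_stream hF hmap hU _ k a i) (iIndepFun_oracle_stream hF hmap hU _ k a)
    (fun i => memLp_oracle_stream hmap hU (hL2 (R.point k ω a)) k a i)
    (fun i => integral_oracle_stream hF hmap hU _ k a i)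
    (fun i => integral_sq_oracle_stream hF hmap hU _ k a i)
    (e := e * R.Δ k ω ^ 2) (by positivity)).trans ?_
  exact ENNReal.ofReal_le_ofReal (error_bound_le hlam hD (hR.radius_le k ω) he
    (variance_nonneg _ _) (hV _))

/-- Almost surely, all estimates of late iterations are accurate. -/
lemma ae_eventually_accurate
    (hF : Measurable fun z : EuclideanSpace ℝ (Fin d) × (Fin q → ℝ) => P.F z.1 z.2)
    (hmap : Measurable fun z : EuclideanSpace ℝ (Fin d) × (Fin q → ℝ) => P.invMap z.1 z.2)
    (hL2 : ∀ θ, MemLp (P.F θ) 2 (P.law θ)) (hV : ∀ θ, Var[P.F θ; P.law θ] ≤ V)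
    (hf : Measurable P.objective) {δ : ℝ} (hδ : 0 < δ)
    (hU : IsUniformSampling ν U) (hR : IsRun P par (fun k => (k : ℝ) ^ (1 + δ)) 2 θ₀ U R)
    {e : ℝ} (he : 0 < e) :
    ∀ᵐ ω ∂ν, ∃ K : ℕ, ∀ k, K ≤ k → ∀ a,
      |R.estimate P par (fun k => (k : ℝ) ^ (1 + δ)) 2 U k a ω - P.objective (R.point k ω a)| ≤
        e * R.Δ k ω ^ 2 := by
  set lam : ℕ → ℝ := fun k => (k : ℝ) ^ (1 + δ) with hlam
  have hae : ∀ a, ∀ᵐ ω ∂ν, ∃ K : ℕ, ∀ k, K ≤ k →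
      |R.estimate P par lam 2 U k a ω - P.objective (R.point k ω a)| ≤ e * R.Δ k ω ^ 2 := by
    intro a
    -- The index is shifted because the deflator vanishes at 0, where the error bound is not
    -- available.
    set A : ℕ → Set Ω := fun k => {ω | e * R.Δ (k + 1) ω ^ 2 <
      |R.estimate P par lam 2 U (k + 1) a ω - P.objective (R.point (k + 1) ω a)|} with hA
    set C : ℝ := V * (3 * (4 * V + par.σminSq +
      (par.n₀ + 4) * par.κas ^ 2 * max par.Δ₀ par.Δmax ^ 4)) * par.κas ^ 2 /
        (par.σminSq * e) ^ 2 with hC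
    have hbound : ∀ k, ν (A k) ≤ ENNReal.ofReal (C / lam (k + 1)) := fun k =>
      measure_estimate_error_le hF hmap hL2 hV hf hU hR
        (by rw [hlam]; exact Real.one_le_rpow (by push_cast; linarith [k.cast_nonneg (α := ℝ)])
              (by linarith)) a he
    have hsum : Summable fun k : ℕ => C / lam (k + 1) := by
      have h1 : Summable fun k : ℕ => C * (1 / (k : ℝ) ^ (1 + δ)) :=
        (Real.summable_one_div_nat_rpow.2 (by linarith)).mul_left C
      have h2 := (summable_nat_add_iff 1).2 h1
      refine h2.congr fun k => ?_
      rw [hlam, mul_one_div]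
    have hfin : ∑' k, ν (A k) ≠ ∞ :=
      ne_top_of_le_ne_top hsum.tsum_ofReal_ne_top (ENNReal.tsum_le_tsum hbound)
    filter_upwards [ae_eventually_notMem hfin] with ω hω
    obtain ⟨K, hK⟩ := Filter.eventually_atTop.1 hω
    refine ⟨K + 1, fun k hk => ?_⟩
    obtain ⟨j, rfl⟩ : ∃ j, k = j + 1 := ⟨k - 1, by omega⟩
    exact not_lt.1 (hK j (by omega))
  filter_upwards [ae_all_iff.2 hae] with ω hω
  choose K hK using hω
  exact ⟨Finset.univ.sup K, fun k hk a => hK a k ((Finset.le_sup (Finset.mem_univ a)).trans hk)⟩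

end AlongRun

/-! ### Paths with accurate estimates -/

section Path

variable {d q : ℕ} {P : Problem d q}

/-- For a suitable accuracy, eventual accuracy of the estimates makes the squared radii summable and
keeps the radii above a multiple of `ε` until an `ε`-stationary incumbent is found. -/
lemma exists_accuracy (par : Params) (hf : Differentiable ℝ P.objective) {L : NNReal}
    (hL : LipschitzWith L (gradient P.objective)) (hbdd : BddBelow (Set.range P.objective)) :
    ∃ e : ℝ, 0 < e ∧ ∀ {Ω : Type*} {lam : ℕ → ℝ} {γ : ℝ}
      {θ₀ : EuclideanSpace ℝ (Fin d)} {U : ℕ → Option (Node d) → ℕ → Ω → (Fin q → ℝ)}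
      {R : Trajectory Ω d}, IsRun P par lam γ θ₀ U R → ∀ ω K,
      (∀ k, K ≤ k → ∀ a, |R.estimate P par lam γ U k a ω - P.objective (R.point k ω a)| ≤
        e * R.Δ k ω ^ 2) →
      (Summable fun k => R.Δ k ω ^ 2) ∧ ∃ c : ℝ, 0 < c ∧ ∀ ε : ℝ, 0 < ε → ε ≤ 1 → ∀ k,
        (∀ j < k, ε < ‖gradient P.objective (R.θ j ω)‖) → c * ε ≤ R.Δ k ω := by
  obtain ⟨τ, hτ, hsucc⟩ := exists_success_threshold hf hL par.η_lt_one par.ηTilde_pos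
  obtain ⟨κ, hκ, hdec⟩ := exists_decrease_constant hf hL par.η_pos par.ηTilde_pos
  obtain ⟨m, hm⟩ := hbdd
  -- With `e ≤ κ / 4`, the net decrease `(κ - 2 e) Δ²` is still at least `κ / 2 * Δ²`.
  refine ⟨min 1 (κ / 4), by positivity, ?_⟩
  intro Ω lam γ θ₀ U R hR ω K hacc
  set e := min 1 (κ / 4) with he
  have he0 : 0 ≤ e := by positivity
  have he1 : e ≤ 1 := min_le_left _ _
  have heκ : e ≤ κ / 4 := min_le_right _ _
  have hcand : ∀ k, K ≤ k → |R.estimate P par lam γ U k none ω - P.objective (R.cand k ω)| ≤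
      e * R.Δ k ω ^ 2 := fun k hk => hacc k hk none
  have hnodes : ∀ k, K ≤ k → NodesAccurate P.objective (R.θ k ω) (R.Δ k ω) e
      fun i => R.estimate P par lam γ U k (some i) ω := fun k hk i => hacc k hk (some i)
  constructor
  · refine summable_sq_radius (S := fun k => R.Success P par lam γ U k ω) (K := K)
      (φ := fun k => P.objective (R.θ k ω)) (κ := κ / 2) (m := m) (fun k => hR.radius_pos k ω)
      par.one_lt_γup par.γlow_pos par.γlow_lt_one (by positivity) (fun k => hm ⟨_, rfl⟩) ?_ ?_
    · intro k hk hS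
      obtain ⟨h1, h2⟩ := hR.step_success k ω hS
      refine ⟨by rw [h2]; exact min_le_left _ _, ?_⟩
      obtain ⟨h3, h4⟩ := hS
      rw [Trajectory.surrogate, gradient_model] at h4
      have h5 := hdec _ _ _ e _ _ _ (hR.radius_pos k ω) he1 (hR.interpolates k ω) (hnodes k hk)
        (hR.cand_min k ω) (hcand k hk) h3 h4
      rw [h1]
      have h6 : 0 ≤ R.Δ k ω ^ 2 := sq_nonneg _
      nlinarith
    · intro k _ hS
      obtain ⟨h1, h2⟩ := hR.step_failure k ω hS
      exact ⟨h2, by rw [h1]⟩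
  · refine exists_radius_lower_bound (S := fun k => R.Success P par lam γ U k ω) (K := K)
      (G := fun k => ‖gradient P.objective (R.θ k ω)‖) (fun k => hR.radius_pos k ω) par.one_lt_γup
      par.γlow_pos hτ par.Δmax_pos ?_ (fun k hS => (hR.step_success k ω hS).2)
      fun k hS => (hR.step_failure k ω hS).2
    intro k hk hle
    have := hsucc _ _ _ e _ _ _ (hR.radius_pos k ω) he0 he1 (hR.interpolates k ω) (hnodes k hk)
      (hR.cand_mem k ω) (hR.cand_min k ω) (hcand k hk) hle
    refine ⟨this.1, ?_⟩
    rw [Trajectory.surrogate, gradient_model]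
    exact this.2

end Path

/-! ### The running minimum of the radii -/

section RunningMin

/-- The running minimum of a sequence. -/
noncomputable def runningMin (x : ℕ → ℝ) : ℕ → ℝ
  | 0 => x 0
  | k + 1 => min (runningMin x k) (x (k + 1))

variable {x : ℕ → ℝ}

lemma le_runningMin_iff {c : ℝ} {k : ℕ} : c ≤ runningMin x k ↔ ∀ j ≤ k, c ≤ x j := by
  induction k with
  | zero => simp [runningMin]
  | succ k ih =>
    rw [runningMin, le_min_iff, ih]
    refine ⟨fun h j hj => ?_, fun h => ⟨fun j hj => h j (hj.trans (Nat.le_succ k)), h _ le_rfl⟩⟩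
    rcases hj.lt_or_eq with hj | rfl
    · exact h.1 j (Nat.lt_succ_iff.1 hj)
    · exact h.2

lemma runningMin_le {j k : ℕ} (h : j ≤ k) : runningMin x k ≤ x j :=
  le_runningMin_iff.1 le_rfl j h

lemma runningMin_pos (hx : ∀ k, 0 < x k) (k : ℕ) : 0 < runningMin x k := by
  induction k with
  | zero => exact hx 0
  | succ k ih => exact lt_min ih (hx _)

/-- All `k + 1` terms dominate the squared running minimum. The factor `k` is kept because it is the
base of the deflator `k ^ (1 + δ)`. -/
lemma natCast_mul_runningMin_sq_le (hx : ∀ k, 0 < x k) (k : ℕ) :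
    k * runningMin x k ^ 2 ≤ ∑ j ∈ Finset.range (k + 1), x j ^ 2 := by
  have h0 := runningMin_pos hx k
  calc k * runningMin x k ^ 2 ≤ ∑ _j ∈ Finset.range (k + 1), runningMin x k ^ 2 := by
        rw [Finset.sum_const, Finset.card_range, nsmul_eq_mul]
        gcongr
        simp
    _ ≤ _ := Finset.sum_le_sum fun j hj =>
        pow_le_pow_left₀ h0.le (runningMin_le (Nat.lt_succ_iff.1 (Finset.mem_range.1 hj))) 2

lemma measurable_runningMin {Ω : Type*} [MeasurableSpace Ω] {X : ℕ → Ω → ℝ} {k : ℕ}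
    (hX : ∀ j ≤ k, Measurable (X j)) : Measurable fun ω => runningMin (fun j => X j ω) k := by
  induction k with
  | zero => exact hX 0 le_rfl
  | succ k ih => exact (ih fun j hj => hX j (hj.trans (Nat.le_succ k))).min (hX _ le_rfl)

/-- The terms of a series of nonnegative numbers whose partial sums have not exceeded `M` sum up to
at most `M`. -/
lemma tsum_truncated_le (hx : ∀ k, 0 ≤ x k) (M : ℝ) :
    ∑' k, (if ∑ j ∈ Finset.range (k + 1), x j ≤ M then ENNReal.ofReal (x k) else 0) ≤
      ENNReal.ofReal M := by
  refine ENNReal.tsum_le_of_sum_range_le fun n => ?_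
  suffices h : ∑ k ∈ Finset.range n,
      (if ∑ j ∈ Finset.range (k + 1), x j ≤ M then ENNReal.ofReal (x k) else 0) ≤
        ENNReal.ofReal (min M (∑ j ∈ Finset.range n, x j)) from
    h.trans (ENNReal.ofReal_le_ofReal (min_le_left _ _))
  induction n with
  | zero => simp
  | succ n ih =>
    have h0 : 0 ≤ ∑ j ∈ Finset.range n, x j := Finset.sum_nonneg fun j _ => hx j
    rw [Finset.sum_range_succ]
    split_ifs with h
    · rw [min_eq_right h, Finset.sum_range_succ, ENNReal.ofReal_add h0 (hx n)]
      gcongr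
      exact ih.trans (ENNReal.ofReal_le_ofReal (min_le_right _ _))
    · rw [add_zero]
      refine ih.trans (ENNReal.ofReal_le_ofReal (min_le_min le_rfl ?_))
      rw [Finset.sum_range_succ]
      linarith [hx n]

end RunningMin

/-! ### The weighted number of samples -/

section Weighted

/-- `D` is the running minimum and `E` the current radius. The factor `D ^ (2 + 2δ)` pays for the
deflator through `k D² ≤ A`, and the remaining `D⁶ ≤ E⁶` beats the `E⁻⁴` of the sampling rate,
leaving the summable `E²`. -/
lemma weighted_meanSizeBound_le {par : Params} {δ V M A D E : ℝ} {k : ℕ} (hδ : 0 < δ) (hV : 0 ≤ V)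
    (hD : 0 < D) (hDE : D ≤ E) (hEM : E ≤ M) (hA : k * D ^ 2 ≤ A) :
    D ^ (8 + 2 * δ) * meanSizeBound par ((k : ℝ) ^ (1 + δ)) 2 E V ≤
      3 * ((4 * V + par.σminSq) / par.κas ^ 2 * A ^ (1 + δ) + (par.n₀ + 3) * M ^ (6 + 2 * δ) +
        A ^ (1 + δ) * M ^ 4) * E ^ 2 := by
  have hκ := par.κas_pos
  have hσ := par.σminSq_pos
  have hE : 0 < E := hD.trans_le hDE
  have hk0 : (0 : ℝ) ≤ k := k.cast_nonneg
  have hA0 : 0 ≤ A := le_trans (by positivity) hA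
  set l : ℝ := (k : ℝ) ^ (1 + δ) with hl
  have hl0 : 0 ≤ l := Real.rpow_nonneg hk0 _
  have hlD : l * D ^ (2 + 2 * δ) ≤ A ^ (1 + δ) := by
    have : D ^ (2 + 2 * δ) = (D ^ 2) ^ (1 + δ) := by
      rw [← Real.rpow_two, ← Real.rpow_mul hD.le]; ring_nf
    rw [this, hl, ← Real.mul_rpow hk0 (by positivity)]
    gcongr
  have hs : D ^ (8 + 2 * δ) = D ^ (2 + 2 * δ) * D ^ 6 := by
    rw [← Real.rpow_natCast, ← Real.rpow_add hD]; norm_num; ring_nf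
  have hs' : D ^ (8 + 2 * δ) = D ^ (6 + 2 * δ) * D ^ 2 := by
    rw [← Real.rpow_natCast, ← Real.rpow_add hD]; norm_num; ring_nf
  have h1 : D ^ (8 + 2 * δ) * samplingRate par l 2 E ≤ A ^ (1 + δ) / par.κas ^ 2 * E ^ 2 := by
    have hr : D ^ (8 + 2 * δ) * samplingRate par l 2 E =
        (l * D ^ (2 + 2 * δ)) * D ^ 6 / (par.κas ^ 2 * E ^ 4) := by
      rw [samplingRate, Real.rpow_two, hs]
      ring
    rw [hr]
    calc (l * D ^ (2 + 2 * δ)) * D ^ 6 / (par.κas ^ 2 * E ^ 4)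
        ≤ A ^ (1 + δ) * E ^ 6 / (par.κas ^ 2 * E ^ 4) := by gcongr
      _ = _ := by field_simp
  have h2 : D ^ (8 + 2 * δ) * l ≤ A ^ (1 + δ) * M ^ 4 * E ^ 2 := by
    calc D ^ (8 + 2 * δ) * l = (l * D ^ (2 + 2 * δ)) * (D ^ 4 * D ^ 2) := by rw [hs]; ring
      _ ≤ A ^ (1 + δ) * (M ^ 4 * E ^ 2) := by
          have := hDE.trans hEM
          gcongr
      _ = _ := by ring
  have h3 : D ^ (8 + 2 * δ) ≤ M ^ (6 + 2 * δ) * E ^ 2 := by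
    rw [hs']
    have h := hDE.trans hEM
    have := Real.rpow_nonneg (hD.le.trans h) (6 + 2 * δ)
    gcongr
  have h4 : (0 : ℝ) ≤ par.n₀ + 3 := by positivity
  have h5 := mul_le_mul_of_nonneg_left h3 h4
  have h6 := mul_le_mul_of_nonneg_left h1 (by positivity : 0 ≤ 4 * V + par.σminSq)
  rw [meanSizeBound, baseSize]
  have e1 : (4 * V + par.σminSq) * (A ^ (1 + δ) / par.κas ^ 2 * E ^ 2) =
    (4 * V + par.σminSq) / par.κas ^ 2 * A ^ (1 + δ) * E ^ 2 := by ring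
  rw [e1] at h6
  linarith

variable {Ω : Type*} [mΩ : MeasurableSpace Ω] {ν : Measure Ω} [IsProbabilityMeasure ν] {d q : ℕ}
  {P : Problem d q} {par : Params} {V : ℝ} {θ₀ : EuclideanSpace ℝ (Fin d)}
  {U : ℕ → Option (Node d) → ℕ → Ω → (Fin q → ℝ)} {R : Trajectory Ω d}

/-- Almost surely, if the squared radii are summable, then so are the sample sizes weighted by a
power of the running minimum of the radii. -/
lemma ae_tsum_weighted_size_lt_top
    (hF : Measurable fun z : EuclideanSpace ℝ (Fin d) × (Fin q → ℝ) => P.F z.1 z.2)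
    (hmap : Measurable fun z : EuclideanSpace ℝ (Fin d) × (Fin q → ℝ) => P.invMap z.1 z.2)
    (hL2 : ∀ θ, MemLp (P.F θ) 2 (P.law θ)) (hV : ∀ θ, Var[P.F θ; P.law θ] ≤ V) {δ : ℝ} (hδ : 0 < δ)
    (hU : IsUniformSampling ν U) (hR : IsRun P par (fun k => (k : ℝ) ^ (1 + δ)) 2 θ₀ U R) :
    ∀ᵐ ω ∂ν, (Summable fun k => R.Δ k ω ^ 2) →
      ∑' k, ENNReal.ofReal (runningMin (fun j => R.Δ j ω) k ^ (8 + 2 * δ)) *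
        ∑ a, (R.size P par (fun k => (k : ℝ) ^ (1 + δ)) 2 U k a ω : ℝ≥0∞) < ∞ := by
  classical
  set lam : ℕ → ℝ := fun k => (k : ℝ) ^ (1 + δ) with hlam
  have ho := measurable_oracle hF hmap
  have hV0 : 0 ≤ V := (variance_nonneg _ _).trans (hV θ₀)
  set S : ℕ → Ω → ℝ := fun k ω => ∑ j ∈ Finset.range (k + 1), R.Δ j ω ^ 2 with hS
  -- The cut-off uses the partial sum of squared radii up to `k`, which is known before iteration
  -- `k` is sampled. The event that the whole series is at most `M` would look into the future and
  -- destroy independence.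
  set w : ℕ → ℕ → Ω → ℝ≥0∞ := fun M k ω => if S k ω ≤ M then
    ENNReal.ofReal (runningMin (fun j => R.Δ j ω) k ^ (8 + 2 * δ)) else 0 with hw
  have hΔm : ∀ k, ∀ j ≤ k, Measurable[streamSigma U (pastIndices d k)] (R.Δ j) := fun k j hj =>
    (hR.measurable_state ho j).2.mono (streamSigma_mono (pastIndices_mono hj)) le_rfl
  have hwm : ∀ M k, Measurable[streamSigma U (pastIndices d k)] (w M k) := by
    intro M k
    let _ : MeasurableSpace Ω := streamSigma U (pastIndices d k)
    refine Measurable.ite (measurableSet_le (Finset.measurable_fun_sum _ fun j hj =>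
      (hΔm k j (Nat.lt_succ_iff.1 (Finset.mem_range.1 hj))).pow_const 2) measurable_const)
      (((measurable_runningMin (hΔm k)).pow_const _).ennreal_ofReal) measurable_const
  have hNm : ∀ k a, Measurable fun ω => (R.size P par lam 2 U k a ω : ℝ≥0∞) := by
    intro k a
    have hp := (hR.measurable_point_prior ho k a).mono (hU.streamSigma_le _) le_rfl
    have hD := (hR.measurable_radius_prior ho k a).mono (hU.streamSigma_le _) le_rfl
    exact (Measurable.of_discrete (f := ENat.toENNReal)).comp (measurable_sampleSize par hD
      (y := fun i ω => P.oracle (R.point k ω a) (U k a i ω))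
      fun i => ho.comp (hp.prodMk (hU.measurable k a i)))
  have hwm' : ∀ M k, Measurable (w M k) := fun M k => (hwm M k).mono (hU.streamSigma_le _) le_rfl
  have hterm : ∀ M k, Measurable fun ω => w M k ω * ∑ a, (R.size P par lam 2 U k a ω : ℝ≥0∞) :=
    fun M k => (hwm' M k).mul (Finset.measurable_fun_sum _ fun a _ => hNm k a)
  have hmain : ∀ M : ℕ, ∀ᵐ ω ∂ν,
      ∑' k, w M k ω * ∑ a, (R.size P par lam 2 U k a ω : ℝ≥0∞) < ∞ := by
    intro M
    refine ae_lt_top (Measurable.tsum fun k => hterm M k) ?_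
    set C : ℝ := 3 * ((4 * V + par.σminSq) / par.κas ^ 2 * (M : ℝ) ^ (1 + δ) +
      (par.n₀ + 3) * (max par.Δ₀ par.Δmax) ^ (6 + 2 * δ) +
        (M : ℝ) ^ (1 + δ) * (max par.Δ₀ par.Δmax) ^ 4) with hC
    have hpt : ∀ k ω, w M k ω * ENNReal.ofReal (meanSizeBound par (lam k) 2 (R.Δ k ω) V) ≤
        ENNReal.ofReal C * (if S k ω ≤ M then ENNReal.ofReal (R.Δ k ω ^ 2) else 0) := by
      intro k ω
      have hpos := runningMin_pos (x := fun j => R.Δ j ω) (fun j => hR.radius_pos j ω) k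
      simp only [hw]
      split_ifs with h
      · rw [← ENNReal.ofReal_mul (Real.rpow_nonneg hpos.le _), ← ENNReal.ofReal_mul' (sq_nonneg _)]
        exact ENNReal.ofReal_le_ofReal (weighted_meanSizeBound_le hδ hV0 hpos
          (runningMin_le (x := fun j => R.Δ j ω) le_rfl) (hR.radius_le k ω)
          ((natCast_mul_runningMin_sq_le (fun j => hR.radius_pos j ω) k).trans h))
      · simp
    have hle : ∫⁻ ω, ∑' k, w M k ω * ∑ a, (R.size P par lam 2 U k a ω : ℝ≥0∞) ∂ν ≤
        (Fintype.card (Option (Node d)) : ℝ≥0∞) * (ENNReal.ofReal C * ENNReal.ofReal M) := by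
      calc ∫⁻ ω, ∑' k, w M k ω * ∑ a, (R.size P par lam 2 U k a ω : ℝ≥0∞) ∂ν
          = ∑' k, ∑ a, ∫⁻ ω, w M k ω * (R.size P par lam 2 U k a ω : ℝ≥0∞) ∂ν := by
            rw [lintegral_tsum fun k => (hterm M k).aemeasurable]
            refine tsum_congr fun k => ?_
            simp_rw [Finset.mul_sum]
            exact lintegral_finsetSum _ fun a _ => (hwm' M k).mul (hNm k a)
        _ ≤ ∑' k, ∑ _a : Option (Node d), ∫⁻ ω, ENNReal.ofReal C *
              (if S k ω ≤ M then ENNReal.ofReal (R.Δ k ω ^ 2) else 0) ∂ν := by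
            refine ENNReal.tsum_le_tsum fun k => Finset.sum_le_sum fun a _ => ?_
            exact (lintegral_mul_size_le hF hmap hL2 hV hU hR
              (Real.rpow_nonneg k.cast_nonneg _) a ((hwm M k).mono
                (streamSigma_mono (pastIndices_subset k a)) le_rfl)).trans
              (lintegral_mono fun ω => hpt k ω)
        _ = Fintype.card (Option (Node d)) * ∫⁻ ω, ENNReal.ofReal C *
              ∑' k, (if S k ω ≤ M then ENNReal.ofReal (R.Δ k ω ^ 2) else 0) ∂ν := by
            simp_rw [Finset.sum_const, Finset.card_univ, nsmul_eq_mul]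
            rw [ENNReal.tsum_mul_left, ← lintegral_tsum]
            · simp_rw [ENNReal.tsum_mul_left]
            · intro k
              have hD : ∀ j, Measurable (R.Δ j) := fun j =>
                (hR.measurable_state ho j).2.mono (hU.streamSigma_le _) le_rfl
              exact (Measurable.const_mul (Measurable.ite (measurableSet_le
                (Finset.measurable_fun_sum _ fun j _ => (hD j).pow_const 2) measurable_const)
                ((hD k).pow_const 2).ennreal_ofReal measurable_const) _).aemeasurable
        _ ≤ Fintype.card (Option (Node d)) * ∫⁻ _ω, ENNReal.ofReal C * ENNReal.ofReal M ∂ν := by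
            gcongr with ω
            exact tsum_truncated_le (x := fun k => R.Δ k ω ^ 2) (fun k => sq_nonneg _) _
        _ = _ := by rw [lintegral_const, measure_univ, mul_one]
    refine ne_top_of_le_ne_top ?_ hle
    exact ENNReal.mul_ne_top (ENNReal.natCast_ne_top _)
      (ENNReal.mul_ne_top ENNReal.ofReal_ne_top ENNReal.ofReal_ne_top)
  filter_upwards [ae_all_iff.2 hmain] with ω hω hsum
  -- For `M` above the full sum the cut-off never acts on this path.
  obtain ⟨M, hM⟩ := exists_nat_ge (∑' k, R.Δ k ω ^ 2)
  refine lt_of_le_of_lt (ENNReal.tsum_le_tsum fun k => ?_) (hω M)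
  have hSM : S k ω ≤ M := (hsum.sum_le_tsum _ fun j _ => sq_nonneg _).trans hM
  simp only [hw, if_pos hSM, le_refl]

end Weighted

/-! ### The sample complexity -/

section Complexity

variable {Ω : Type*} {d q : ℕ} {P : Problem d q} {par : Params} {lam : ℕ → ℝ} {γ : ℝ}
  {U : ℕ → Option (Node d) → ℕ → Ω → (Fin q → ℝ)} {R : Trajectory Ω d}

lemma lt_norm_gradient_of_le_hittingTime {ε : ℝ} {ω : Ω} {k : ℕ}
    (h : (k : ℕ∞) ≤ hittingTime P R ε ω) :
    ∀ j < k, ε < ‖gradient P.objective (R.θ j ω)‖ := by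
  intro j hj
  by_contra hle
  have h1 : (k : ℕ∞) ≤ j := h.trans
    (iInf₂_le (f := fun (i : ℕ) (_ : i ∈ {i : ℕ | ‖gradient P.objective (R.θ i ω)‖ ≤ ε}) => (i : ℕ∞))
      j (not_lt.1 hle))
  exact absurd hj (not_lt.2 (by exact_mod_cast h1))

/-- Every iteration counted in the complexity has weight at least `(c ε) ^ s`, so multiplying the
weighted series by `(c ε) ^ (-s)` dominates it term by term. -/
lemma exists_sampleComplexity_bound {ω : Ω} {s c : ℝ} (hs : 0 < s) (hc : 0 < c)
    (hlow : ∀ ε : ℝ, 0 < ε → ε ≤ 1 → ∀ k,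
      (∀ j < k, ε < ‖gradient P.objective (R.θ j ω)‖) → c * ε ≤ R.Δ k ω)
    (hfin : ∑' k, ENNReal.ofReal (runningMin (fun j => R.Δ j ω) k ^ s) *
        ∑ a, (R.size P par lam γ U k a ω : ℝ≥0∞) < ∞) :
    ∃ C : ℝ, ∀ ε : ℝ, 0 < ε → ε ≤ 1 →
      sampleComplexity P par lam γ U R ε ω ≤ ENNReal.ofReal (C * ε ^ (-s)) := by
  set T := ∑' k, ENNReal.ofReal (runningMin (fun j => R.Δ j ω) k ^ s) *
    ∑ a, (R.size P par lam γ U k a ω : ℝ≥0∞) with hT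
  refine ⟨c ^ (-s) * T.toReal, fun ε hε hε1 => ?_⟩
  have hcε : 0 < c * ε := mul_pos hc hε
  have hright : ENNReal.ofReal (c ^ (-s) * T.toReal * ε ^ (-s)) =
      ENNReal.ofReal ((c * ε) ^ (-s)) * T := by
    rw [Real.mul_rpow hc.le hε.le, mul_right_comm, ENNReal.ofReal_mul (by positivity),
      ENNReal.ofReal_toReal hfin.ne]
  rw [hright, hT, ← ENNReal.tsum_mul_left, sampleComplexity]
  refine ENNReal.tsum_le_tsum fun k => ?_
  split_ifs with hk
  · rw [← mul_assoc, ← ENNReal.ofReal_mul (by positivity)]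
    refine le_mul_of_one_le_left (zero_le) (ENNReal.one_le_ofReal.2 ?_)
    have hle : c * ε ≤ runningMin (fun j => R.Δ j ω) k := le_runningMin_iff.2 fun j hj =>
      hlow ε hε hε1 j fun i hi => lt_norm_gradient_of_le_hittingTime hk i (hi.trans_le hj)
    calc (1 : ℝ) = (c * ε) ^ (-s) * (c * ε) ^ s := by
          rw [← Real.rpow_add hcε, neg_add_cancel, Real.rpow_zero]
      _ ≤ _ := by gcongr
  · exact zero_le

end Complexity

/-! ### Comparison with the stratified exponents -/

lemma stratExponentBounded_lt (q : ℕ) {δ : ℝ} (hδ : 0 < δ) :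
    stratExponentBounded q δ < 8 + 2 * δ := by
  have hq : (0 : ℝ) ≤ q := q.cast_nonneg
  rw [stratExponentBounded, div_lt_iff₀ (by positivity)]
  nlinarith

/-- After clearing the denominator the gap is exactly `6 + 2δ - ϱ q`, so the condition on `ϱ` is
sharp. -/
lemma stratExponentPoly_lt {q : ℕ} {δ ϱ : ℝ} (h : ϱ * q < 6 + 2 * δ) :
    stratExponentPoly q δ ϱ < 8 + 2 * δ := by
  rw [stratExponentPoly, div_lt_iff₀ (by positivity)]
  linarith

/-- The denominator is at least `κmin - 2 bmax > 0`, and the gap after clearing it is `(6 + 2δ)(κmin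
- 2 bmax)`. -/
lemma stratExponentExp_lt (q : ℕ) {δ κmin bmax : ℝ} (hδ : 0 < δ) (hκ : 0 < κmin)
    (hb : 2 * bmax < κmin) : stratExponentExp q δ κmin bmax < 8 + 2 * δ := by
  have hq : (0 : ℝ) ≤ q * κmin := by positivity
  rw [stratExponentExp, div_lt_iff₀ (by linarith)]
  nlinarith [mul_pos hδ (sub_pos.2 hb)]

end SampledTrustRegion

theorem mainTheorem6 {d q : ℕ} (P : Problem d q) (par : Params)
    (θ₀ : EuclideanSpace ℝ (Fin d)) (δ : ℝ) (hδ : 0 < δ)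
    (hF : Measurable fun z : EuclideanSpace ℝ (Fin d) × (Fin q → ℝ) => P.F z.1 z.2)
    (hmap : Measurable fun z : EuclideanSpace ℝ (Fin d) × (Fin q → ℝ) => P.invMap z.1 z.2)
    (hL2 : ∀ θ, MemLp (P.F θ) 2 (P.law θ))
    (hvar : ∃ V : ℝ, ∀ θ, Var[P.F θ; P.law θ] ≤ V)
    (hdiff : Differentiable ℝ P.objective)
    (hlip : ∃ L, LipschitzWith L (gradient P.objective))
    (hbdd : BddBelow (Set.range P.objective))
    {Ω : Type*} [MeasurableSpace Ω] (ν : Measure Ω) [IsProbabilityMeasure ν]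
    (U : ℕ → Option (Node d) → ℕ → Ω → (Fin q → ℝ)) (hU : IsUniformSampling ν U)
    (R : Trajectory Ω d) (hR : IsRun P par (fun k => (k : ℝ) ^ (1 + δ)) 2 θ₀ U R) :
    (∀ᵐ ω ∂ν, ∃ C ε₀ : ℝ, 0 < ε₀ ∧ ∀ ε : ℝ, 0 < ε → ε ≤ ε₀ →
        sampleComplexity P par (fun k => (k : ℝ) ^ (1 + δ)) 2 U R ε ω ≤
          ENNReal.ofReal (C * ε ^ (-(8 + 2 * δ)))) ∧
      stratExponentBounded q δ < 8 + 2 * δ ∧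
      (∀ ϱ : ℝ, 0 < ϱ → ϱ * q < 6 + 2 * δ → stratExponentPoly q δ ϱ < 8 + 2 * δ) ∧
      (∀ κmin bmax : ℝ, 0 < κmin → 2 * bmax < κmin →
        stratExponentExp q δ κmin bmax < 8 + 2 * δ) := by
  refine ⟨?_, stratExponentBounded_lt q hδ, fun ϱ _ h => stratExponentPoly_lt h,
    fun κmin bmax hκ hb => stratExponentExp_lt q hδ hκ hb⟩
  obtain ⟨V, hV⟩ := hvar
  obtain ⟨L, hL⟩ := hlip
  -- The accuracy depends on the objective and the parameters, not on `ω`, so one null set suffices.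
  obtain ⟨e, he, hpath⟩ := exists_accuracy par hdiff hL hbdd
  filter_upwards [ae_eventually_accurate hF hmap hL2 hV hdiff.continuous.measurable hδ hU hR he,
    ae_tsum_weighted_size_lt_top hF hmap hL2 hV hδ hU hR] with ω ⟨K, hK⟩ hω
  obtain ⟨hsum, c, hc, hlow⟩ := hpath hR ω K hK
  obtain ⟨C, hC⟩ := exists_sampleComplexity_bound (by linarith) hc hlow (hω hsum)
  exact ⟨C, 1, one_pos, hC⟩
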